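/- For integers $s_1,\dots,s_r\ge 1$, signs $\sigma_i\in\{\pm1\}$ and parities $\varepsilon_i\in\{\pm1\}$ put $$M^{\varepsilon_1,\dots,\varepsilon_r}_{\sigma_1,\dots,\sigma_r}(s_1,\dots,s_r)=\sum_{m_1>\cdots>m_r>0}\ \prod_{i=1}^r\frac{(1+\varepsilon_i(-1)^{m_i})\,\sigma_i^{(2m_i+1-\varepsilon_i)/4}}{m_i^{s_i}},$$ understood as the limit for $N\to\infty$ of the sums restricted to $m_1<N$. Write $\mathrm{ev}=1$, $\mathrm{od}=-1$, and set $$S^{\sigma_1,\dots,\sigma_r}(s_1,\dots,s_r)=M^{\dots,\mathrm{od},\mathrm{ev},\mathrm{od},\mathrm{ev}}_{\sigma_1,\dots,\sigma_r}(s_1,\dots,s_r),\qquad t^{\sigma_1,\dots,\sigma_r}(s_1,\dots,s_r)=\frac1{2^r}M^{\mathrm{od},\dots,\mathrm{od}}_{\sigma_1,\dots,\sigma_r}(s_1,\dots,s_r),$$ $$\zeta^{\sigma_1,\dots,\sigma_r}(s_1,\dots,s_r)=\frac{2^{s_1+\cdots+s_r}}{2^r}M^{\mathrm{ev},\dots,\mathrm{ev}}_{\sigma_1,\dots,\sigma_r}(s_1,\dots,s_r).$$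 A bar over $s_i$ means $\sigma_i=-1$, no bar means $\sigma_i=1$, and $\{1\}_n$ is the string of $n$ ones. In particular $\zeta(\overline p)=\sum_{n\ge1}(-1)^n/n^p$ and $$t(\overline1,\overline{2\ell+1})=\sum_{m_1>m_2>0}\frac{(-1)^{m_1}(-1)^{m_2}}{(2m_1-1)(2m_2-1)^{2\ell+1}}.$$ Let $\zeta(q)=\sum_{n\ge1}1/n^q$ for $q\ge 2$ and $\beta(s)=\sum_{n\ge1}(-1)^{n-1}/(2n-1)^s$ for $s\ge1$ (limits of partial sums). **Theorem.** For every integer $\ell\ge1$ all the series occurring below converge, and $$\begin{aligned} S(\overline2,\{1\}_{2\ell-1},\overline1)={}&\sum_{\substack{p+r+2k=2\ell-1\\k,p,r\ge0}}2(-1)^{1+k+p}\beta(r+1)\,(2-2^{-p})\,\zeta(\overline{p+1})\,\frac1{(2k+1)!}\Big(\frac\pi2\Big)^{2k+1}\\ &+\sum_{\substack{p+r=2\ell\\p,r\ge0}}2(-1)^p\beta(r+1)\beta(p+1)+\sum_{\substack{p+q=2\ell+2\\p,q\ge1}}(-1)^p\zeta(\overline p)\zeta(\overline q)\\ &+\sum_{\substack{p+q=2\ell+2\\p\ge1,\,q\ge2}}2(-1)^{p+1}\zeta(\overline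 p)\zeta(q)+2\zeta(\overline{2\ell+2})+2\zeta(\overline{2\ell+1},1)-4\,t(\overline1,\overline{2\ell+1}). \end{aligned}$$ -/

import Mathlib

open Filter Topology

noncomputable section

namespace AMMV

/-- The factor `(1 + ε (-1)^m) σ^((2m + 1 - ε)/4) / m^s` of one summation index `m`, for a
parity `ε = ±1` (`1` is even, `-1` is odd), a sign `σ = ±1` and an exponent `s`.
The first factor vanishes unless `m` has parity `ε`, and then `4 ∣ 2m + 1 - ε`, so that the
integer division in the exponent is exact wherever the term is nonzero. -/
def term (ε σ : ℤˣ) (s m : ℕ) : ℝ :=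
  (1 + ((ε : ℤ) : ℝ) * (-1) ^ m) *
    ((((σ ^ ((2 * (m : ℤ) + 1 - (ε : ℤ)) / 4) : ℤˣ) : ℤ)) : ℝ) / (m : ℝ) ^ s

/-- The truncated alternating multiple mixed value: the sum over
`N > m₁ > m₂ > ⋯ > m_r > 0` of the product of the factors `term εᵢ σᵢ sᵢ mᵢ`,
the data being given by the list of the triples `(εᵢ, σᵢ, sᵢ)`. -/
def trunc : List (ℤˣ × ℤˣ × ℕ) → ℕ → ℝ
  | [], _ => 1
  | (ε, σ, s) :: L, N => ∑ m ∈ Finset.Ico 1 N, term ε σ s m * trunc L m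

/-- The series defining the alternating multiple mixed value converges (as the limit of its
truncations at `m₁ < N`; convergence need not be absolute). -/
def Converges (L : List (ℤˣ × ℤˣ × ℕ)) : Prop :=
  ∃ x : ℝ, Tendsto (trunc L) atTop (𝓝 x)

/-- The alternating multiple mixed value `M^{ε₁,…,ε_r}_{σ₁,…,σ_r}(s₁,…,s_r)`
(meaningful when `Converges L`). -/
def M (L : List (ℤˣ × ℤˣ × ℕ)) : ℝ := limUnder atTop (trunc L)

/-- Attach to a list of pairs `(σᵢ, sᵢ)` the parities `…, od, ev, od, ev`. -/
def parityS : List (ℤˣ × ℕ) → List (ℤˣ × ℤˣ × ℕ)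
  | [] => []
  | (σ, s) :: L => ((-1) ^ L.length, σ, s) :: parityS L

/-- Attach to a list of pairs `(σᵢ, sᵢ)` the constant parity `ε`. -/
def parityConst (ε : ℤˣ) (L : List (ℤˣ × ℕ)) : List (ℤˣ × ℤˣ × ℕ) :=
  L.map fun a => (ε, a.1, a.2)

/-- The alternating multiple `S` value; the list holds the pairs `(σᵢ, sᵢ)`. -/
def S (L : List (ℤˣ × ℕ)) : ℝ := M (parityS L)

/-- The alternating multiple `t` value: all indices odd, normalised by `2^{-r}`. -/
def t (L : List (ℤˣ × ℕ)) : ℝ := M (parityConst (-1) L) / 2 ^ L.length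

/-- The alternating multiple zeta value: all indices even, normalised by
`2^{s₁ + ⋯ + s_r} / 2^r`. -/
def zeta (L : List (ℤˣ × ℕ)) : ℝ :=
  2 ^ (L.map Prod.snd).sum / 2 ^ L.length * M (parityConst 1 L)

/-- An argument `s` without a bar: sign `+1`. -/
def pl (s : ℕ) : ℤˣ × ℕ := (1, s)

/-- An argument `s` with a bar: sign `-1`. -/
def bar (s : ℕ) : ℤˣ × ℕ := (-1, s)

/-- The Riemann zeta value `∑_{n ≥ 1} 1 / n^s` at an integer `s ≥ 2`. -/
def rzeta (s : ℕ) : ℝ := ∑' n : ℕ, 1 / ((n : ℝ) + 1) ^ s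

theorem rzeta_eq_riemannZeta (s : ℕ) (hs : 2 ≤ s) : (rzeta s : ℂ) = riemannZeta s := by
  have h := zeta_eq_tsum_one_div_nat_add_one_cpow (s := (s : ℂ)) (by simpa using by omega)
  rw [h, rzeta, Complex.ofReal_tsum]
  simp

/-- The partial sums of the Dirichlet beta series
`∑_{n ≥ 1} (-1)^(n-1) / (2n-1)^s` (the index is shifted by one). -/
def betaTrunc (s N : ℕ) : ℝ := ∑ n ∈ Finset.range N, (-1) ^ n / (2 * (n : ℝ) + 1) ^ s

/-- The Dirichlet beta value at an integer `s ≥ 1`. -/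
def beta (s : ℕ) : ℝ := limUnder atTop (betaTrunc s)

/-- The argument string `(2̄, {1}_{2ℓ-1}, 1̄)`. -/
def args (l : ℕ) : List (ℤˣ × ℕ) := bar 2 :: (List.replicate (2 * l - 1) (pl 1) ++ [bar 1])

end AMMV

end

noncomputable section

namespace AMMV

/-! ### Dirichlet series of periodic functions and their double sums -/

/-! The outermost summand of the truncated `S` value is `(Complex.I ^ m).re * bco (2 * l) m / m`
(`trunc_args`), where the numbers `bco j m` are the Taylor coefficients of iterated integrals L_j
with L_0(x) = -log(1 + x²) and L_{j+1}' = 2 L_j / (1 - x²). The Cayley substitution x = (z - 1)/(z +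
1) turns 2 dx/(1 - x²) into dz/z. Hence L_j(x) is a polynomial in log z minus a polylogarithm-like
series in z with coefficients `quad` (`feqDiff_succ_eq_zero`). At z = exp(iθ) one has x = i
tan(θ/2), and real parts give a cosine series plus a polynomial in θ. With t = tan(θ/2), dt/t =
dθ/sin θ, so integration over 0 < θ < π/2 divides the m-th coefficient by m and expresses `S`
through the integrals `cosInt` and `powInt` (`tsum_bco_div`).

The integrals `powInt` come from the geometric sum of exp(i(2k+1)θ) and the Riemann-Lebesgue lemma:
they produce the products of beta values and powers of π, together with sums over odd integers
(`I_pow_re_mul_powInt`). The integrals `cosInt n` are not expanded. A recurrence in steps of two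
relates them to shifted sums: n · `hat₂ oddInd n` = `cosInt n` + 2 χ(n) · `hat chi n`
(`mul_hat₂_oddInd`).

Products of Dirichlet series are handled by partial fractions: an alternating sum over the weights
of products of two series becomes a pair of double sums with kernel 1/(m + n) (`sum_LSer_mul_LSer`,
`sum_LSer_mul_LSer_of_bounded`). For `quad` and `oddInd` this makes all `cosInt` cancel
(`S_args_eq`). There remain the terms with π, a double sum in χ, and a double sum of `oddInd`
against `hat quad`. Writing `oddInd` as 1 - `alt` and `quad` as 2 `alt` - 2 `altEven` splits the
latter into three pieces: two are products of zeta values by the same partial fractions, with the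
double zeta value as a correction, and the third is the `t` value. Many of the series converge only
conditionally, so double sums are always taken as limits of square truncations, with an absolutely
summable outer weight and uniformly bounded inner sums. -/

/-- The conditionally convergent Dirichlet series `∑_{n ≥ 1} f n / n ^ p`. -/
def LSer (f : ℕ → ℝ) (p : ℕ) : ℝ :=
  limUnder atTop fun N => ∑ n ∈ Finset.Ico 1 N, f n / (n : ℝ) ^ p

/-- The shifted sum `∑_{n ≥ 1} f n / (m + n)`. -/
def hat (f : ℕ → ℝ) (m : ℕ) : ℝ :=
  limUnder atTop fun N => ∑ n ∈ Finset.Ico 1 N, f n / ((m : ℝ) + n)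

/-- The partial sums of `f` from index `1` on are bounded. -/
def BddPartial (f : ℕ → ℝ) : Prop :=
  ∃ B, ∀ N, |∑ n ∈ Finset.Ico 1 N, f n| ≤ B

theorem sum_mul_eq_by_parts (a z : ℕ → ℝ) (N : ℕ) :
    ∑ i ∈ Finset.range N, a i * z i = a N * ∑ i ∈ Finset.range N, z i +
      ∑ i ∈ Finset.range N, (a i - a (i + 1)) * ∑ j ∈ Finset.range (i + 1), z j := by
  induction N with
  | zero => simp
  | succ N ih =>
    rw [Finset.sum_range_succ, ih, Finset.sum_range_succ (fun i => (a i - a (i + 1)) * _),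
      Finset.sum_range_succ z]
    ring

/-- After summation by parts the weights `a N` and `a i - a (i + 1)` are nonnegative and telescope
to `a 0`. The explicit constant is what later gives bounds uniform in a parameter. -/
theorem abs_sum_mul_le {a z : ℕ → ℝ} {B : ℝ} (ha : Antitone a) (ha0 : ∀ i, 0 ≤ a i)
    (hz : ∀ N, |∑ i ∈ Finset.range N, z i| ≤ B) (N : ℕ) :
    |∑ i ∈ Finset.range N, a i * z i| ≤ a 0 * B := by
  rw [sum_mul_eq_by_parts]
  have h1 : |a N * ∑ i ∈ Finset.range N, z i| ≤ a N * B := by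
    rw [abs_mul, abs_of_nonneg (ha0 N)]
    exact mul_le_mul_of_nonneg_left (hz N) (ha0 N)
  have h2 : |∑ i ∈ Finset.range N, (a i - a (i + 1)) * ∑ j ∈ Finset.range (i + 1), z j|
      ≤ (a 0 - a N) * B := by
    refine (Finset.abs_sum_le_sum_abs _ _).trans ?_
    rw [← Finset.sum_range_sub' a N, Finset.sum_mul]
    refine Finset.sum_le_sum fun i _ => ?_
    have := sub_nonneg.2 (ha (Nat.le_succ i))
    rw [abs_mul, abs_of_nonneg this]
    exact mul_le_mul_of_nonneg_left (hz _) this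
  calc _ ≤ _ := abs_add_le _ _
    _ ≤ a N * B + (a 0 - a N) * B := add_le_add h1 h2
    _ = a 0 * B := by ring

theorem dirichlet_test_Ico {f : ℕ → ℝ} {B : ℝ}
    (hf : ∀ N, |∑ n ∈ Finset.Ico 1 N, f n| ≤ B)
    {a : ℕ → ℝ} (ha : Antitone fun i => a (1 + i)) (ha0 : ∀ i, 0 ≤ a (1 + i))
    (hlim : Tendsto (fun i => a (1 + i)) atTop (𝓝 0)) :
    (∃ x, Tendsto (fun N => ∑ n ∈ Finset.Ico 1 N, a n * f n) atTop (𝓝 x)) ∧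
      ∀ N, |∑ n ∈ Finset.Ico 1 N, a n * f n| ≤ a 1 * B := by
  have hz : ∀ N, |∑ i ∈ Finset.range N, f (1 + i)| ≤ B := fun N => by
    have := hf (N + 1)
    rwa [Finset.sum_Ico_eq_sum_range] at this
  constructor
  · obtain ⟨x, hx⟩ := cauchySeq_tendsto_of_complete
      (ha.cauchySeq_series_mul_of_tendsto_zero_of_bounded hlim (z := fun i => f (1 + i)) hz)
    refine ⟨x, ?_⟩
    have := hx.comp (tendsto_sub_atTop_nat 1)
    refine this.congr fun N => ?_
    simp [Finset.sum_Ico_eq_sum_range]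
  · intro N
    rw [Finset.sum_Ico_eq_sum_range]
    exact abs_sum_mul_le ha ha0 hz _

/-- The weights 1/(m + n) decrease in n and are at most 1 at n = 1, so Dirichlet's test gives one
constant valid for all shifts m and all cutoffs N. This is the dominating constant in the limits of
double sums. -/
theorem BddPartial.hat_spec {f : ℕ → ℝ} (hf : BddPartial f) :
    ∃ B, 0 ≤ B ∧ ∀ m : ℕ,
      Tendsto (fun N => ∑ n ∈ Finset.Ico 1 N, f n / ((m : ℝ) + n)) atTop (𝓝 (hat f m)) ∧
      ∀ N, |∑ n ∈ Finset.Ico 1 N, f n / ((m : ℝ) + n)| ≤ B := by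
  obtain ⟨B, hB⟩ := hf
  have hB0 : 0 ≤ B := (abs_nonneg _).trans (hB 0)
  refine ⟨B, hB0, fun m => ?_⟩
  have h := dirichlet_test_Ico hB (a := fun n : ℕ => ((m : ℝ) + n)⁻¹)
    (fun i j hij => by
      have : (i : ℝ) ≤ j := by exact_mod_cast hij
      simp only [Nat.cast_add, Nat.cast_one]
      gcongr)
    (fun i => by positivity)
    (by
      refine tendsto_inv_atTop_zero.comp (tendsto_atTop_mono (f := fun i : ℕ => (i : ℝ)) (fun i => ?_)
        tendsto_natCast_atTop_atTop)
      push_cast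
      have : (0 : ℝ) ≤ m := by positivity
      linarith)
  have e : ∀ N : ℕ, ∑ n ∈ Finset.Ico 1 N, ((m : ℝ) + n)⁻¹ * f n
      = ∑ n ∈ Finset.Ico 1 N, f n / ((m : ℝ) + n) := fun N =>
    Finset.sum_congr rfl fun n _ => by rw [div_eq_mul_inv, mul_comm]
  simp only [e] at h
  refine ⟨tendsto_nhds_limUnder h.1, fun N => (h.2 N).trans ?_⟩
  refine mul_le_of_le_one_left hB0 (inv_le_one_of_one_le₀ ?_)
  have : (0 : ℝ) ≤ m := by positivity
  push_cast
  linarith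

theorem BddPartial.exists_bound_hat {f : ℕ → ℝ} (hf : BddPartial f) :
    ∃ B, 0 ≤ B ∧ ∀ m : ℕ, |hat f m| ≤ B := by
  obtain ⟨B, hB, h⟩ := hf.hat_spec
  exact ⟨B, hB, fun m => le_of_tendsto (h m).1.abs (Eventually.of_forall (h m).2)⟩

theorem BddPartial.tendsto_hat {f : ℕ → ℝ} (hf : BddPartial f) (m : ℕ) :
    Tendsto (fun N => ∑ n ∈ Finset.Ico 1 N, f n / ((m : ℝ) + n)) atTop (𝓝 (hat f m)) := by
  obtain ⟨B, hB, h⟩ := hf.hat_spec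
  exact (h m).1

theorem BddPartial.tendsto_LSer {f : ℕ → ℝ} (hf : BddPartial f) {p : ℕ} (hp : 1 ≤ p) :
    Tendsto (fun N => ∑ n ∈ Finset.Ico 1 N, f n / (n : ℝ) ^ p) atTop (𝓝 (LSer f p)) := by
  obtain ⟨B, hB⟩ := hf
  have h := dirichlet_test_Ico hB (a := fun n : ℕ => ((n : ℝ) ^ p)⁻¹)
    (fun i j hij => by
      have : (i : ℝ) ≤ j := by exact_mod_cast hij
      simp only [Nat.cast_add, Nat.cast_one]
      gcongr)
    (fun i => by positivity)
    (by
      refine tendsto_inv_atTop_zero.comp (tendsto_atTop_mono (f := fun i : ℕ => (i : ℝ)) (fun i => ?_)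
        tendsto_natCast_atTop_atTop)
      push_cast
      have h1 : (1 : ℝ) ≤ 1 + i := by have : (0 : ℝ) ≤ i := by positivity
                                      linarith
      exact (by linarith : (i : ℝ) ≤ 1 + i).trans (le_self_pow₀ h1 (by omega)))
  have e : ∀ N : ℕ, ∑ n ∈ Finset.Ico 1 N, ((n : ℝ) ^ p)⁻¹ * f n
      = ∑ n ∈ Finset.Ico 1 N, f n / (n : ℝ) ^ p := fun N =>
    Finset.sum_congr rfl fun n _ => by rw [div_eq_mul_inv, mul_comm]
  simp only [e] at h
  exact tendsto_nhds_limUnder h.1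

theorem tendsto_sum_Ico_tsum {w : ℕ → ℝ} (hw : Summable w) (hw0 : w 0 = 0) :
    Tendsto (fun N => ∑ n ∈ Finset.Ico 1 N, w n) atTop (𝓝 (∑' n, w n)) := by
  refine (hw.hasSum.tendsto_sum_nat).congr fun N => ?_
  rcases N with _ | N
  · simp
  · rw [Finset.range_eq_Ico, Finset.sum_eq_sum_Ico_succ_bot (Nat.succ_pos N), hw0, zero_add]

/-- Tannery's theorem with the outer cutoff moving together with the inner one, as it does for
square truncations of a double series. -/
theorem tendsto_sum_Ico_mul {w : ℕ → ℝ} (hw : Summable w) (hw0 : w 0 = 0)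
    {u : ℕ → ℕ → ℝ} {v : ℕ → ℝ} {C : ℝ}
    (hu : ∀ m, 1 ≤ m → Tendsto (fun N => u N m) atTop (𝓝 (v m)))
    (hC : ∀ N m, 1 ≤ m → |u N m| ≤ C) :
    Tendsto (fun N => ∑ m ∈ Finset.Ico 1 N, w m * u N m) atTop (𝓝 (∑' m, w m * v m)) := by
  have key := tendsto_tsum_of_dominated_convergence (𝓕 := atTop) (β := ℕ)
    (f := fun N m => if m ∈ Finset.Ico 1 N then w m * u N m else 0)
    (g := fun m => w m * v m) (bound := fun m => |w m| * C) (hw.abs.mul_right C) ?_ ?_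
  · refine key.congr fun N => ?_
    rw [tsum_eq_sum (s := Finset.Ico 1 N) (fun m hm => if_neg hm)]
    exact Finset.sum_congr rfl fun m hm => if_pos hm
  · intro m
    rcases Nat.eq_zero_or_pos m with rfl | hm
    · simp [hw0]
    · refine ((hu m hm).const_mul (w m)).congr' ?_
      filter_upwards [eventually_gt_atTop m] with N hN
      rw [if_pos (Finset.mem_Ico.2 ⟨hm, hN⟩)]
  · refine Eventually.of_forall fun N m => ?_
    split_ifs with h
    · rw [Real.norm_eq_abs, abs_mul]
      exact mul_le_mul_of_nonneg_left (hC N m (Finset.mem_Ico.1 h).1) (abs_nonneg _)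
    · rw [norm_zero]
      rcases Nat.eq_zero_or_pos m with rfl | hm
      · simp [hw0]
      · exact mul_nonneg (abs_nonneg _) ((abs_nonneg _).trans (hC 0 m hm))

theorem BddPartial.exists_bound {f : ℕ → ℝ} (hf : BddPartial f) :
    ∃ B, ∀ n, 1 ≤ n → |f n| ≤ B := by
  obtain ⟨B, hB⟩ := hf
  refine ⟨B + B, fun n hn => ?_⟩
  have h : f n = ∑ i ∈ Finset.Ico 1 (n + 1), f i - ∑ i ∈ Finset.Ico 1 n, f i := by
    rw [Finset.sum_Ico_succ_top hn]; ring
  rw [h]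
  exact (abs_sub _ _).trans (add_le_add (hB _) (hB _))

theorem summable_div_pow {f : ℕ → ℝ} (hf : ∃ B, ∀ n, 1 ≤ n → |f n| ≤ B) {s : ℕ} (hs : 2 ≤ s) :
    Summable fun n : ℕ => f n / (n : ℝ) ^ s := by
  obtain ⟨B, hB⟩ := hf
  refine Summable.of_norm_bounded ((Real.summable_one_div_nat_pow.2 (by omega : 1 < s)).mul_left B)
    fun n => ?_
  rcases Nat.eq_zero_or_pos n with rfl | hn
  · simp [show s ≠ 0 by omega]
  · rw [Real.norm_eq_abs, abs_div, abs_of_nonneg (by positivity : (0 : ℝ) ≤ (n : ℝ) ^ s),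
      mul_one_div]
    gcongr
    exact hB n hn

theorem LSer_eq_tsum {f : ℕ → ℝ} (hf : ∃ B, ∀ n, 1 ≤ n → |f n| ≤ B) {s : ℕ} (hs : 2 ≤ s) :
    LSer f s = ∑' n : ℕ, f n / (n : ℝ) ^ s :=
  (tendsto_sum_Ico_tsum (summable_div_pow hf hs) (by simp [show s ≠ 0 by omega])).limUnder_eq

theorem tendsto_LSer_of_bounded {f : ℕ → ℝ} (hf : ∃ B, ∀ n, 1 ≤ n → |f n| ≤ B) {s : ℕ}
    (hs : 2 ≤ s) :
    Tendsto (fun N => ∑ n ∈ Finset.Ico 1 N, f n / (n : ℝ) ^ s) atTop (𝓝 (LSer f s)) := by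
  rw [LSer_eq_tsum hf hs]
  exact tendsto_sum_Ico_tsum (summable_div_pow hf hs) (by simp [show s ≠ 0 by omega])

/-! ### Products of Dirichlet series by partial fractions -/

/-- Alternating geometric sum: `∑_{p+q=k} (-1)^p x^(p+1) y^(q+1)`. -/
theorem sum_antidiagonal_neg_one_pow (x y : ℝ) (k : ℕ) :
    (x + y) * ∑ a ∈ Finset.HasAntidiagonal.antidiagonal k, (-1 : ℝ) ^ a.1 * (x ^ (a.1 + 1) * y ^ (a.2 + 1)) =
      x * y * (y ^ (k + 1) - (-x) ^ (k + 1)) := by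
  have h := Commute.geom_sum₂_mul (Commute.all (-x) y) (k + 1)
  rw [Nat.add_sub_cancel, ← Nat.succ_eq_add_one,
    ← Finset.Nat.sum_antidiagonal_eq_sum_range_succ (fun i j => (-x) ^ i * y ^ j) k] at h
  have e : ∑ a ∈ Finset.HasAntidiagonal.antidiagonal k, (-1 : ℝ) ^ a.1 * (x ^ (a.1 + 1) * y ^ (a.2 + 1)) =
      x * y * ∑ a ∈ Finset.HasAntidiagonal.antidiagonal k, (-x) ^ a.1 * y ^ a.2 := by
    rw [Finset.mul_sum]
    refine Finset.sum_congr rfl fun a _ => ?_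
    rw [neg_pow x]
    ring
  rw [e]
  rw [Nat.succ_eq_add_one] at h
  linear_combination (-x * y) * h

/-- Take x = 1/n and y = 1/m in the geometric sum: the odd exponent 2l + 1 turns the difference of
powers into a sum, and dividing by 1/n + 1/m produces the kernel 1/(n + m). -/
theorem sum_antidiagonal_even (n m : ℝ) (hn : 0 < n) (hm : 0 < m) (l : ℕ) :
    ∑ a ∈ Finset.HasAntidiagonal.antidiagonal (2 * l), (-1 : ℝ) ^ a.1 *
      (1 / n ^ (a.1 + 1) * (1 / m ^ (a.2 + 1))) =
      1 / m ^ (2 * l + 1) * (1 / (m + n)) + 1 / n ^ (2 * l + 1) * (1 / (n + m)) := by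
  have h := sum_antidiagonal_neg_one_pow (1 / n) (1 / m) (2 * l)
  have hne : 1 / n + 1 / m ≠ 0 := by positivity
  simp only [one_div_pow] at h
  refine mul_left_cancel₀ hne (h.trans ?_)
  rw [Odd.neg_pow ⟨l, rfl⟩, one_div_pow]
  field_simp
  ring

/-- One power of 1/m is split off, so the second exponent is at least 2. The associated series then
needs only bounded coefficients, which admits the constant 1 and `oddInd`. -/
theorem sum_antidiagonal_odd (n m : ℝ) (hn : 0 < n) (hm : 0 < m) (l : ℕ) (hl : 1 ≤ l) :
    ∑ a ∈ Finset.HasAntidiagonal.antidiagonal (2 * l - 1), (-1 : ℝ) ^ a.1 *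
      (1 / n ^ (a.1 + 1) * (1 / m ^ (a.2 + 2))) =
      1 / m ^ (2 * l + 1) * (1 / (m + n)) - 1 / n ^ (2 * l) * (1 / (m * (n + m))) := by
  obtain ⟨k, rfl⟩ : ∃ k, l = k + 1 := ⟨l - 1, by omega⟩
  have h := sum_antidiagonal_neg_one_pow (1 / n) (1 / m) (2 * (k + 1) - 1)
  have hne : 1 / n + 1 / m ≠ 0 := by positivity
  have e : ∑ a ∈ Finset.HasAntidiagonal.antidiagonal (2 * (k + 1) - 1), (-1 : ℝ) ^ a.1 *
      (1 / n ^ (a.1 + 1) * (1 / m ^ (a.2 + 2))) = 1 / m *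
      ∑ a ∈ Finset.HasAntidiagonal.antidiagonal (2 * (k + 1) - 1), (-1 : ℝ) ^ a.1 *
      ((1 / n) ^ (a.1 + 1) * (1 / m) ^ (a.2 + 1)) := by
    rw [Finset.mul_sum]
    refine Finset.sum_congr rfl fun a _ => ?_
    rw [one_div_pow, one_div_pow, pow_succ m (a.2 + 1), one_div_mul_eq_div, one_div, one_div,
      one_div]
    field_simp
  rw [e]
  refine mul_left_cancel₀ hne ?_
  rw [mul_left_comm, h, show 2 * (k + 1) - 1 + 1 = 2 * (k + 1) by omega, Even.neg_pow ⟨k + 1, by ring⟩,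
    one_div_pow, one_div_pow]
  field_simp
  ring

/-- Product of two Dirichlet series summed over the weights, in terms of shifted sums. -/
theorem sum_LSer_mul_LSer {f g : ℕ → ℝ} (hf : BddPartial f) (hg : BddPartial g) {l : ℕ}
    (hl : 1 ≤ l) :
    ∑ a ∈ Finset.HasAntidiagonal.antidiagonal (2 * l), (-1 : ℝ) ^ a.1 * (LSer f (a.1 + 1) * LSer g (a.2 + 1)) =
      ∑' m : ℕ, g m / (m : ℝ) ^ (2 * l + 1) * hat f m +
        ∑' n : ℕ, f n / (n : ℝ) ^ (2 * l + 1) * hat g n := by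
  obtain ⟨B, -, hB⟩ := hf.hat_spec
  obtain ⟨B', -, hB'⟩ := hg.hat_spec
  have h1 := tendsto_sum_Ico_mul (summable_div_pow hg.exists_bound (by omega : 2 ≤ 2 * l + 1))
    (by simp) (fun m _ => (hB m).1) (fun N m _ => (hB m).2 N)
  have h2 := tendsto_sum_Ico_mul (summable_div_pow hf.exists_bound (by omega : 2 ≤ 2 * l + 1))
    (by simp) (fun m _ => (hB' m).1) (fun N m _ => (hB' m).2 N)
  have h3 := tendsto_finsetSum (Finset.HasAntidiagonal.antidiagonal (2 * l)) fun a _ =>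
    (((hf.tendsto_LSer (Nat.le_add_left 1 a.1)).mul
      (hg.tendsto_LSer (Nat.le_add_left 1 a.2))).const_mul ((-1 : ℝ) ^ a.1))
  refine tendsto_nhds_unique h3 ((h1.add h2).congr fun N => ?_)
  have e1 : ∀ a : ℕ × ℕ, (-1 : ℝ) ^ a.1 * ((∑ n ∈ Finset.Ico 1 N, f n / (n : ℝ) ^ (a.1 + 1)) *
      ∑ n ∈ Finset.Ico 1 N, g n / (n : ℝ) ^ (a.2 + 1)) =
      ∑ n ∈ Finset.Ico 1 N, ∑ m ∈ Finset.Ico 1 N, f n * g m * ((-1 : ℝ) ^ a.1 *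
        (1 / (n : ℝ) ^ (a.1 + 1) * (1 / (m : ℝ) ^ (a.2 + 1)))) := fun a => by
    rw [Finset.sum_mul_sum, Finset.mul_sum]
    refine Finset.sum_congr rfl fun n _ => ?_
    rw [Finset.mul_sum]
    exact Finset.sum_congr rfl fun m _ => by ring
  simp only [e1]
  simp only [Finset.mul_sum]
  rw [Finset.sum_comm, ← Finset.sum_add_distrib, Finset.sum_comm (s := Finset.HasAntidiagonal.antidiagonal (2 * l))]
  refine Finset.sum_congr rfl fun n hn => ?_
  rw [Finset.sum_comm (s := Finset.HasAntidiagonal.antidiagonal (2 * l)), ← Finset.sum_add_distrib]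
  refine Finset.sum_congr rfl fun m hm => ?_
  rw [← Finset.mul_sum, sum_antidiagonal_even _ _ (by exact_mod_cast (Finset.mem_Ico.1 hn).1)
    (by exact_mod_cast (Finset.mem_Ico.1 hm).1)]
  ring

/-- The bilinear sum `∑_{m ≥ 1} g m / (m (n + m))`. -/
def hat₂ (g : ℕ → ℝ) (n : ℕ) : ℝ := ∑' m : ℕ, g m / ((m : ℝ) * (n + m))

theorem abs_div_mul_add_le {g : ℕ → ℝ} {B : ℝ} (hB : ∀ n, 1 ≤ n → |g n| ≤ B) (n m : ℕ) :
    |g m / ((m : ℝ) * (n + m))| ≤ B * (1 / (m : ℝ) ^ 2) := by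
  rcases Nat.eq_zero_or_pos m with rfl | hm
  · simp
  have hm' : (0 : ℝ) < m := by exact_mod_cast hm
  rw [abs_div, abs_of_pos (by positivity : (0 : ℝ) < (m : ℝ) * (n + m)), mul_one_div, pow_two]
  refine div_le_div₀ ((abs_nonneg _).trans (hB m hm)) (hB m hm) (by positivity) ?_
  refine mul_le_mul_of_nonneg_left ?_ hm'.le
  linarith [(by positivity : (0 : ℝ) ≤ n)]

theorem summable_hat₂ {g : ℕ → ℝ} (hg : ∃ B, ∀ n, 1 ≤ n → |g n| ≤ B) (n : ℕ) :
    Summable fun m : ℕ => g m / ((m : ℝ) * (n + m)) := by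
  obtain ⟨B, hB⟩ := hg
  exact Summable.of_norm_bounded ((Real.summable_one_div_nat_pow.2 one_lt_two).mul_left B)
    fun m => abs_div_mul_add_le hB n m

theorem tendsto_hat₂ {g : ℕ → ℝ} (hg : ∃ B, ∀ n, 1 ≤ n → |g n| ≤ B) (n : ℕ) :
    Tendsto (fun N => ∑ m ∈ Finset.Ico 1 N, g m / ((m : ℝ) * (n + m))) atTop (𝓝 (hat₂ g n)) :=
  tendsto_sum_Ico_tsum (summable_hat₂ hg n) (by simp)

theorem sum_LSer_mul_LSer_of_bounded {f g : ℕ → ℝ} (hf : BddPartial f)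
    (hg : ∃ B, ∀ n, 1 ≤ n → |g n| ≤ B) {l : ℕ} (hl : 1 ≤ l) :
    ∑ a ∈ Finset.HasAntidiagonal.antidiagonal (2 * l - 1),
        (-1 : ℝ) ^ a.1 * (LSer f (a.1 + 1) * LSer g (a.2 + 2)) =
      ∑' m : ℕ, g m / (m : ℝ) ^ (2 * l + 1) * hat f m -
        ∑' n : ℕ, f n / (n : ℝ) ^ (2 * l) * hat₂ g n := by
  obtain ⟨B, -, hB⟩ := hf.hat_spec
  obtain ⟨G, hG⟩ := hg
  have hg : ∃ B, ∀ n, 1 ≤ n → |g n| ≤ B := ⟨G, hG⟩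
  have h1 := tendsto_sum_Ico_mul (summable_div_pow hg (by omega : 2 ≤ 2 * l + 1))
    (by simp) (fun m _ => (hB m).1) (fun N m _ => (hB m).2 N)
  have h2 := tendsto_sum_Ico_mul (summable_div_pow hf.exists_bound (by omega : 2 ≤ 2 * l))
    (by simp [show l ≠ 0 by omega]) (fun n _ => tendsto_hat₂ hg n)
    -- The denominator m(n + m) is at least m², so this constant bounds the inner sums independently
    -- of n and N.
    (C := ∑' m : ℕ, G * (1 / (m : ℝ) ^ 2))
    (fun N n _ => (Finset.abs_sum_le_sum_abs _ _).trans <|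
      (Finset.sum_le_sum fun m _ => abs_div_mul_add_le hG n m).trans <|
      ((Real.summable_one_div_nat_pow.2 one_lt_two).mul_left G).sum_le_tsum _ fun m _ =>
        mul_nonneg ((abs_nonneg _).trans (hG 1 le_rfl)) (by positivity))
  have h3 := tendsto_finsetSum (Finset.HasAntidiagonal.antidiagonal (2 * l - 1)) fun a _ =>
    (((hf.tendsto_LSer (Nat.le_add_left 1 a.1)).mul
      (tendsto_LSer_of_bounded hg (Nat.le_add_left 2 a.2))).const_mul ((-1 : ℝ) ^ a.1))
  refine tendsto_nhds_unique h3 ((h1.sub h2).congr fun N => ?_)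
  have e1 : ∀ a : ℕ × ℕ, (-1 : ℝ) ^ a.1 * ((∑ n ∈ Finset.Ico 1 N, f n / (n : ℝ) ^ (a.1 + 1)) *
      ∑ n ∈ Finset.Ico 1 N, g n / (n : ℝ) ^ (a.2 + 2)) =
      ∑ n ∈ Finset.Ico 1 N, ∑ m ∈ Finset.Ico 1 N, f n * g m * ((-1 : ℝ) ^ a.1 *
        (1 / (n : ℝ) ^ (a.1 + 1) * (1 / (m : ℝ) ^ (a.2 + 2)))) := fun a => by
    rw [Finset.sum_mul_sum, Finset.mul_sum]
    refine Finset.sum_congr rfl fun n _ => ?_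
    rw [Finset.mul_sum]
    exact Finset.sum_congr rfl fun m _ => by ring
  simp only [e1]
  simp only [Finset.mul_sum]
  rw [Finset.sum_comm, ← Finset.sum_sub_distrib,
    Finset.sum_comm (s := Finset.HasAntidiagonal.antidiagonal (2 * l - 1))]
  refine Finset.sum_congr rfl fun n hn => ?_
  rw [Finset.sum_comm (s := Finset.HasAntidiagonal.antidiagonal (2 * l - 1)), ← Finset.sum_sub_distrib]
  refine Finset.sum_congr rfl fun m hm => ?_
  rw [← Finset.mul_sum, sum_antidiagonal_odd _ _ (by exact_mod_cast (Finset.mem_Ico.1 hn).1)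
    (by exact_mod_cast (Finset.mem_Ico.1 hm).1) l hl]
  ring

/-! ### Periodic coefficient functions -/

/-- The alternating sign `(-1)^n`. -/
def alt (n : ℕ) : ℝ := (-1) ^ n

/-- The sign `(-1)^(n/2)` at even `n`, zero at odd `n`. -/
def altEven (n : ℕ) : ℝ := if Even n then (-1) ^ (n / 2) else 0

/-- The non-principal character modulo `4`. -/
def chi (n : ℕ) : ℝ := if Even n then 0 else (-1) ^ (n / 2)

/-- Twice the indicator function of the odd numbers. -/
def oddInd (n : ℕ) : ℝ := 1 - (-1) ^ n

/-- The function of period `4` with the values `0, -2, 4, -2`. -/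
def quad (n : ℕ) : ℝ := 2 * alt n - 2 * altEven n

theorem sum_range_even {α : Type*} [AddCommMonoid α] (g : ℕ → α) (N : ℕ) :
    ∑ m ∈ Finset.range N, (if Even m then g (m / 2) else 0) =
      ∑ k ∈ Finset.range ((N + 1) / 2), g k := by
  induction N with
  | zero => simp
  | succ N ih =>
    rw [Finset.sum_range_succ, ih]
    rcases Nat.even_or_odd' N with ⟨k, rfl | rfl⟩
    · rw [if_pos (even_two_mul k), show (2 * k + 1) / 2 = k by omega,
        show (2 * k + 1 + 1) / 2 = k + 1 by omega, show 2 * k / 2 = k by omega,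
        Finset.sum_range_succ]
    · rw [if_neg (by simp), show (2 * k + 1 + 1) / 2 = k + 1 by omega,
        show (2 * k + 1 + 1 + 1) / 2 = k + 1 by omega, add_zero]

theorem sum_range_odd {α : Type*} [AddCommMonoid α] (g : ℕ → α) (N : ℕ) :
    ∑ m ∈ Finset.range N, (if Even m then 0 else g (m / 2)) =
      ∑ k ∈ Finset.range (N / 2), g k := by
  induction N with
  | zero => simp
  | succ N ih =>
    rw [Finset.sum_range_succ, ih]
    rcases Nat.even_or_odd' N with ⟨k, rfl | rfl⟩
    · rw [if_pos (even_two_mul k), show (2 * k + 1) / 2 = k by omega,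
        show 2 * k / 2 = k by omega, add_zero]
    · rw [if_neg (by simp), show (2 * k + 1 + 1) / 2 = k + 1 by omega,
        show (2 * k + 1) / 2 = k by omega, Finset.sum_range_succ]

theorem sum_Ico_one_eq_sum_range_sub (f : ℕ → ℝ) {N : ℕ} (hN : N ≠ 0) :
    ∑ m ∈ Finset.Ico 1 N, f m = ∑ m ∈ Finset.range N, f m - f 0 := by
  rw [Finset.range_eq_Ico, Finset.sum_eq_sum_Ico_succ_bot (Nat.pos_of_ne_zero hN)]
  simp

theorem sum_Ico_one_eq_sum_range {f : ℕ → ℝ} (hf : f 0 = 0) (N : ℕ) :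
    ∑ m ∈ Finset.Ico 1 N, f m = ∑ m ∈ Finset.range N, f m := by
  rcases eq_or_ne N 0 with rfl | hN
  · simp
  · rw [sum_Ico_one_eq_sum_range_sub f hN, hf, sub_zero]

theorem bddPartial_of_range {f : ℕ → ℝ} {B : ℝ} (h : ∀ N, |∑ m ∈ Finset.range N, f m| ≤ B) :
    BddPartial f := by
  refine ⟨B + |f 0|, fun N => ?_⟩
  rcases eq_or_ne N 0 with rfl | hN
  · simpa using add_nonneg ((abs_nonneg _).trans (h 0)) (abs_nonneg (f 0))
  · rw [sum_Ico_one_eq_sum_range_sub f hN]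
    exact (abs_sub _ _).trans (add_le_add_left (h N) _)

theorem bddPartial_alt : BddPartial alt :=
  bddPartial_of_range (B := 1) fun N => norm_sum_neg_one_pow_le N

theorem bddPartial_altEven : BddPartial altEven :=
  bddPartial_of_range (B := 1) fun N => by
    simp only [altEven]
    rw [sum_range_even (fun k => (-1 : ℝ) ^ k)]
    exact norm_sum_neg_one_pow_le _

theorem bddPartial_chi : BddPartial chi :=
  bddPartial_of_range (B := 1) fun N => by
    simp only [chi]
    rw [sum_range_odd (fun k => (-1 : ℝ) ^ k)]
    exact norm_sum_neg_one_pow_le _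

theorem bddPartial_quad : BddPartial quad := by
  obtain ⟨A, hA⟩ := bddPartial_alt
  obtain ⟨B, hB⟩ := bddPartial_altEven
  refine ⟨2 * A + 2 * B, fun N => ?_⟩
  simp only [quad, Finset.sum_sub_distrib, ← Finset.mul_sum]
  have h1 := hA N
  have h2 := hB N
  rw [abs_le] at *
  constructor <;> linarith [h1.1, h1.2, h2.1, h2.2]

theorem bounded_oddInd : ∃ B, ∀ n, 1 ≤ n → |oddInd n| ≤ B := by
  refine ⟨2, fun n _ => ?_⟩
  rcases neg_one_pow_eq_or ℝ n with h | h <;> rw [oddInd, h] <;> norm_num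

theorem bounded_one : ∃ B, ∀ n : ℕ, 1 ≤ n → |(fun _ => 1 : ℕ → ℝ) n| ≤ B :=
  ⟨1, fun _ _ => by simp⟩

theorem hat_quad (m : ℕ) : hat quad m = 2 * hat alt m - 2 * hat altEven m := by
  refine tendsto_nhds_unique (bddPartial_quad.tendsto_hat m)
    ((((bddPartial_alt.tendsto_hat m).const_mul 2).sub
      ((bddPartial_altEven.tendsto_hat m).const_mul 2)).congr fun N => ?_)
  rw [Finset.mul_sum, Finset.mul_sum, ← Finset.sum_sub_distrib]
  exact Finset.sum_congr rfl fun n _ => by rw [quad]; ring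

/-- Only n = 2k contributes, with sign (-1)^k; below N there are (N + 1)/2 even numbers including 0,
so the truncations correspond exactly. -/
theorem LSer_altEven {p : ℕ} (hp : 1 ≤ p) : LSer altEven p = LSer alt p / 2 ^ p := by
  have h1 := (bddPartial_altEven.tendsto_LSer hp)
  have h2 := ((bddPartial_alt.tendsto_LSer hp).div_const (2 ^ p)).comp
    (tendsto_atTop_atTop.2 fun b => ⟨2 * b, fun a ha => by omega⟩ :
      Tendsto (fun N : ℕ => (N + 1) / 2) atTop atTop)
  refine tendsto_nhds_unique h1 (h2.congr fun N => ?_)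
  have h0 : p ≠ 0 := by omega
  rw [Function.comp_apply, sum_Ico_one_eq_sum_range (by simp [h0]),
    sum_Ico_one_eq_sum_range (by simp [h0]), Finset.sum_div,
    ← sum_range_even (fun k => alt k / (k : ℝ) ^ p / 2 ^ p)]
  refine Finset.sum_congr rfl fun m _ => ?_
  rw [altEven]
  split_ifs with h
  · obtain ⟨k, rfl⟩ := h
    rw [← two_mul, Nat.mul_div_cancel_left k two_pos, alt, div_div, mul_comm ((k : ℝ) ^ p),
      ← mul_pow]
    push_cast
    rfl
  · simp

/-- This is the origin of the factor 2 - 2^(-p) in the theorem. -/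
theorem LSer_quad (p : ℕ) : LSer quad (p + 1) = (2 - 1 / 2 ^ p) * LSer alt (p + 1) := by
  have h : LSer quad (p + 1) = 2 * LSer alt (p + 1) - 2 * LSer altEven (p + 1) := by
    refine tendsto_nhds_unique (bddPartial_quad.tendsto_LSer (Nat.le_add_left 1 p))
      ((((bddPartial_alt.tendsto_LSer (Nat.le_add_left 1 p)).const_mul 2).sub
        ((bddPartial_altEven.tendsto_LSer (Nat.le_add_left 1 p)).const_mul 2)).congr fun N => ?_)
    rw [Finset.mul_sum, Finset.mul_sum, ← Finset.sum_sub_distrib]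
    exact Finset.sum_congr rfl fun n _ => by rw [quad]; ring
  rw [h, LSer_altEven (Nat.le_add_left 1 p), pow_succ]
  field_simp

/-! ### Identification of the values in the statement -/

theorem term_one_neg (s m : ℕ) : term 1 (-1) s m = 2 * altEven m / (m : ℝ) ^ s := by
  rw [term, altEven]
  rcases Nat.even_or_odd' m with ⟨k, rfl | rfl⟩
  · have e : (2 * ((2 * k : ℕ) : ℤ) + 1 - ((1 : ℤˣ) : ℤ)) / 4 = (k : ℤ) := by push_cast; omega
    rw [e, if_pos (even_two_mul k), Nat.mul_div_cancel_left k two_pos, pow_mul]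
    norm_num
  · rw [if_neg (by simp), Odd.neg_one_pow ⟨k, rfl⟩]
    simp

/-- At m = 2k + 1 the exponent is (2m + 2)/4 = k + 1, one more than in the character, whence the
minus sign. -/
theorem term_neg_neg (s m : ℕ) : term (-1) (-1) s m = -2 * chi m / (m : ℝ) ^ s := by
  rw [term, chi]
  rcases Nat.even_or_odd' m with ⟨k, rfl | rfl⟩
  · rw [if_pos (even_two_mul k), pow_mul]
    simp
  · have e : (2 * ((2 * k + 1 : ℕ) : ℤ) + 1 - ((-1 : ℤˣ) : ℤ)) / 4 = ((k + 1 : ℕ) : ℤ) := by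
      push_cast; omega
    rw [e, if_neg (by simp), Odd.neg_one_pow ⟨k, rfl⟩, show (2 * k + 1) / 2 = k by omega,
      zpow_natCast, pow_succ]
    push_cast
    ring

theorem term_one (ε : ℤˣ) (s m : ℕ) :
    term ε 1 s m = (1 + ((ε : ℤ) : ℝ) * (-1) ^ m) / (m : ℝ) ^ s := by
  simp [term]

theorem trunc_bar (p N : ℕ) : trunc (parityConst 1 [bar p]) N =
    2 * ∑ m ∈ Finset.Ico 1 N, altEven m / (m : ℝ) ^ p := by
  simp only [parityConst, bar, List.map_cons, List.map_nil, trunc, mul_one, Finset.mul_sum]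
  exact Finset.sum_congr rfl fun m _ => by rw [term_one_neg, mul_div_assoc]

theorem tendsto_trunc_bar {p : ℕ} (hp : 1 ≤ p) :
    Tendsto (trunc (parityConst 1 [bar p])) atTop (𝓝 (2 * LSer altEven p)) :=
  ((bddPartial_altEven.tendsto_LSer hp).const_mul 2).congr fun N => (trunc_bar p N).symm

theorem zeta_bar {p : ℕ} (hp : 1 ≤ p) : zeta [bar p] = LSer alt p := by
  rw [zeta, M, (tendsto_trunc_bar hp).limUnder_eq, LSer_altEven hp]
  simp [bar]
  field_simp

theorem tendsto_betaTrunc {s : ℕ} (hs : 1 ≤ s) :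
    Tendsto (betaTrunc s) atTop (𝓝 (LSer chi s)) := by
  have h := (bddPartial_chi.tendsto_LSer hs).comp
    (tendsto_atTop_atTop.2 fun b => ⟨b, fun a ha => by omega⟩ :
      Tendsto (fun N : ℕ => 2 * N) atTop atTop)
  refine h.congr fun N => ?_
  rw [Function.comp_apply, sum_Ico_one_eq_sum_range (by simp [show s ≠ 0 by omega]), betaTrunc]
  have e := sum_range_odd (fun k => (-1 : ℝ) ^ k / (2 * (k : ℝ) + 1) ^ s) (2 * N)
  rw [Nat.mul_div_cancel_left N two_pos] at e
  rw [← e]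
  refine Finset.sum_congr rfl fun m _ => ?_
  rw [chi]
  split_ifs with h
  · simp
  · obtain ⟨k, rfl⟩ := Nat.not_even_iff_odd.1 h
    rw [show (2 * k + 1) / 2 = k by omega]
    push_cast
    rfl

theorem beta_eq {s : ℕ} (hs : 1 ≤ s) : beta s = LSer chi s := (tendsto_betaTrunc hs).limUnder_eq

theorem rzeta_eq {s : ℕ} (hs : 2 ≤ s) : rzeta s = LSer (fun _ => 1) s := by
  rw [LSer_eq_tsum bounded_one hs, (summable_div_pow bounded_one hs).tsum_eq_zero_add, rzeta]
  simp [show s ≠ 0 by omega]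

/-- The harmonic number `∑_{0 < j < k} 1 / j`. -/
def harm (k : ℕ) : ℝ := ∑ j ∈ Finset.Ico 1 k, 1 / (j : ℝ)

theorem harm_nonneg (k : ℕ) : 0 ≤ harm k := Finset.sum_nonneg fun _ _ => by positivity

theorem harm_le (k : ℕ) : harm k ≤ k := by
  calc harm k ≤ ∑ j ∈ Finset.Ico 1 k, (1 : ℝ) := Finset.sum_le_sum fun j hj => by
        have : (1 : ℝ) ≤ j := by exact_mod_cast (Finset.mem_Ico.1 hj).1
        rw [div_le_one (by linarith)]
        exact this
    _ = ((k - 1 : ℕ) : ℝ) := by simp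
    _ ≤ k := by exact_mod_cast Nat.sub_le k 1

theorem summable_alt_mul_harm {l : ℕ} (hl : 1 ≤ l) :
    Summable fun k : ℕ => alt k / (k : ℝ) ^ (2 * l + 1) * harm k := by
  refine Summable.of_norm_bounded (Real.summable_one_div_nat_pow.2 (by omega : 1 < 2 * l))
    fun k => ?_
  rcases Nat.eq_zero_or_pos k with rfl | hk
  · simp [show l ≠ 0 by omega]
  have hk' : (0 : ℝ) < k := by exact_mod_cast hk
  rw [Real.norm_eq_abs, abs_mul, abs_div, alt, abs_neg_one_pow, abs_of_nonneg (harm_nonneg k),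
    abs_of_nonneg (by positivity : (0 : ℝ) ≤ (k : ℝ) ^ (2 * l + 1))]
  calc _ ≤ 1 / (k : ℝ) ^ (2 * l + 1) * k :=
        mul_le_mul_of_nonneg_left (harm_le k) (by positivity)
    _ = _ := by rw [pow_succ]; field_simp

theorem tendsto_trunc_bar_one {l : ℕ} (hl : 1 ≤ l) :
    Tendsto (trunc (parityConst 1 [bar (2 * l + 1), pl 1])) atTop
      (𝓝 (2 / 2 ^ (2 * l + 1) * ∑' k : ℕ, alt k / (k : ℝ) ^ (2 * l + 1) * harm k)) := by
  have h := ((tendsto_sum_Ico_tsum (summable_alt_mul_harm hl) (by simp)).const_mul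
    (2 / 2 ^ (2 * l + 1) : ℝ)).comp
    (tendsto_atTop_atTop.2 fun b => ⟨2 * b, fun a ha => by omega⟩ :
      Tendsto (fun N : ℕ => (N + 1) / 2) atTop atTop)
  refine h.congr fun N => ?_
  have hin : ∀ k : ℕ, ∑ j ∈ Finset.Ico 1 (2 * k), term 1 1 1 j = harm k := fun k => by
    rw [harm, sum_Ico_one_eq_sum_range (by simp [term]), sum_Ico_one_eq_sum_range (by simp)]
    have e := sum_range_even (fun i : ℕ => 1 / (i : ℝ)) (2 * k)
    rw [show (2 * k + 1) / 2 = k by omega] at e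
    rw [← e]
    refine Finset.sum_congr rfl fun j _ => ?_
    rw [term_one]
    split_ifs with hj
    · obtain ⟨i, rfl⟩ := hj
      rw [← two_mul, Nat.mul_div_cancel_left i two_pos, pow_mul]
      rcases Nat.eq_zero_or_pos i with rfl | hi
      · simp
      · have : (i : ℝ) ≠ 0 := by positivity
        push_cast
        field_simp
        norm_num
    · rw [Odd.neg_one_pow (Nat.not_even_iff_odd.1 hj)]
      simp
  simp only [parityConst, bar, pl, List.map_cons, List.map_nil, trunc, mul_one,
    Function.comp_apply]
  rw [sum_Ico_one_eq_sum_range (by simp), sum_Ico_one_eq_sum_range (by simp [term]),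
    Finset.mul_sum, ← sum_range_even]
  refine Finset.sum_congr rfl fun m _ => ?_
  rw [term_one_neg, altEven]
  split_ifs with hm
  · obtain ⟨k, rfl⟩ := hm
    rw [← two_mul, Nat.mul_div_cancel_left k two_pos, hin, alt]
    push_cast
    rw [mul_pow, ← mul_assoc, div_mul_div_comm]
  · simp

theorem zeta_bar_one {l : ℕ} (hl : 1 ≤ l) : zeta [bar (2 * l + 1), pl 1] =
    ∑' k : ℕ, alt k / (k : ℝ) ^ (2 * l + 1) * harm k := by
  rw [zeta, M, (tendsto_trunc_bar_one hl).limUnder_eq]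
  simp [bar, pl]
  rw [pow_succ (2 : ℝ) (2 * l + 1)]
  field_simp

/-- For odd b, b + e is odd exactly when e is even, and the two signs then differ by (-1)^(e/2). In
terms of the difference e of its indices, the `t` value thus becomes a shifted sum of `altEven`. -/
theorem chi_mul_chi_add (b e : ℕ) : chi b * chi (b + e) = oddInd b / 2 * altEven e := by
  rcases Nat.even_or_odd' b with ⟨k, rfl | rfl⟩
  · rw [chi, if_pos (even_two_mul k), oddInd, pow_mul]
    norm_num
  · rw [chi, if_neg (by simp), oddInd, Odd.neg_one_pow ⟨k, rfl⟩, chi, altEven]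
    rcases Nat.even_or_odd' e with ⟨i, rfl | rfl⟩
    · rw [if_neg (by simp [Nat.even_add]), if_pos (even_two_mul i),
        show (2 * k + 1) / 2 = k by omega, show (2 * k + 1 + 2 * i) / 2 = k + i by omega,
        show 2 * i / 2 = i by omega, pow_add, ← mul_assoc, ← mul_pow]
      norm_num
    · rw [if_pos (by simp [Nat.even_add]), if_neg (by simp)]
      ring

theorem tendsto_trunc_bar_one_bar {s : ℕ} (hs : 2 ≤ s) :
    Tendsto (trunc (parityConst (-1) [bar 1, bar s])) atTop
      (𝓝 (4 * ∑' b : ℕ, oddInd b / 2 / (b : ℝ) ^ s * hat altEven b)) := by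
  obtain ⟨B, -, hB⟩ := bddPartial_altEven.hat_spec
  have hsum : Summable fun b : ℕ => oddInd b / 2 / (b : ℝ) ^ s := by
    refine ((summable_div_pow bounded_oddInd hs).div_const 2).congr fun b => ?_
    rw [div_right_comm]
  have h := (tendsto_sum_Ico_mul hsum (by simp [oddInd])
    -- With the larger index written as b + e, the cutoff on e is N - b; the bound over all cutoffs
    -- still dominates.
    (fun b _ => (hB b).1.comp (tendsto_sub_atTop_nat b))
    (fun N b _ => (hB b).2 (N - b))).const_mul 4
  refine h.congr fun N => ?_
  simp only [parityConst, bar, List.map_cons, List.map_nil, trunc, mul_one, Function.comp_apply,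
    term_neg_neg, pow_one, Finset.mul_sum]
  rw [Finset.sum_sigma', Finset.sum_sigma']
  refine Finset.sum_bij' (fun x _ => ⟨x.1 + x.2, x.1⟩) (fun y _ => ⟨y.2, y.1 - y.2⟩) ?_ ?_ ?_ ?_ ?_
  · rintro ⟨b, e⟩ h
    simp only [Finset.mem_sigma, Finset.mem_Ico] at h ⊢
    omega
  · rintro ⟨m, b⟩ h
    simp only [Finset.mem_sigma, Finset.mem_Ico] at h ⊢
    omega
  · rintro ⟨b, e⟩ h
    simp
  · rintro ⟨m, b⟩ h
    simp only [Finset.mem_sigma, Finset.mem_Ico] at h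
    simp only [Nat.add_sub_cancel' h.2.2.le]
  · rintro ⟨b, e⟩ h
    have := chi_mul_chi_add b e
    push_cast
    linear_combination (-4 / (b : ℝ) ^ s / (b + e)) * this

theorem t_bar_one_bar {s : ℕ} (hs : 2 ≤ s) : t [bar 1, bar s] =
    ∑' b : ℕ, oddInd b / 2 / (b : ℝ) ^ s * hat altEven b := by
  rw [t, M, (tendsto_trunc_bar_one_bar hs).limUnder_eq]
  simp only [List.length_cons, List.length_nil]
  ring

/-! ### The coefficients of the iterated integrals -/

/-- The power series coefficients of the iterated integrals whose values are the `S` values. -/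
def bco : ℕ → ℕ → ℝ
  | 0, m => term 1 (-1) 1 m
  | j + 1, m => term ((-1) ^ (j + 1)) 1 1 m * ∑ k ∈ Finset.Ico 1 m, bco j k

theorem bco_zero_right (j : ℕ) : bco j 0 = 0 := by
  cases j <;> simp [bco, term]

theorem term_parity (j m : ℕ) :
    term ((-1) ^ j) 1 1 m = if Even (m + j) then 2 / (m : ℝ) else 0 := by
  have e : (((((-1 : ℤˣ) ^ j : ℤˣ) : ℤ)) : ℝ) * (-1) ^ m = (-1) ^ (m + j) := by
    rw [pow_add, mul_comm]
    push_cast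
    rfl
  rw [term_one, e, pow_one]
  split_ifs with h
  · rw [h.neg_one_pow]; norm_num
  · rw [(Nat.not_even_iff_odd.1 h).neg_one_pow]; norm_num

theorem bco_of_odd {j m : ℕ} (h : ¬ Even (m + j)) : bco j m = 0 := by
  cases j with
  | zero => rw [bco, term_one_neg, altEven, if_neg (by simpa using h)]; simp
  | succ j => rw [bco, term_parity, if_neg h, zero_mul]

theorem mul_bco_succ (j m : ℕ) : (m : ℝ) * bco (j + 1) m =
    if Even (m + (j + 1)) then 2 * ∑ k ∈ Finset.Ico 1 m, bco j k else 0 := by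
  rw [bco, term_parity]
  split_ifs with h
  · rcases Nat.eq_zero_or_pos m with rfl | hm
    · simp
    · field_simp
  · simp

/-- This is the coefficient form of (1 - x²) L_{j+1}' = 2 L_j. Passing from m to m + 2 adds the
inner terms at m and m + 1, of which the one at m vanishes by parity. -/
theorem bco_rec (j m : ℕ) :
    ((m + 2 : ℕ) : ℝ) * bco (j + 1) (m + 2) - m * bco (j + 1) m = 2 * bco j (m + 1) := by
  rw [mul_bco_succ, mul_bco_succ]
  have e : Even (m + 2 + (j + 1)) ↔ Even (m + (j + 1)) := by
    rw [show m + 2 + (j + 1) = m + (j + 1) + 2 by ring, Nat.even_add]; simp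
  by_cases h : Even (m + (j + 1))
  · rw [if_pos h, if_pos (e.2 h), Finset.sum_Ico_succ_top (by omega)]
    rcases Nat.eq_zero_or_pos m with rfl | hm
    · simp
    · have h0 : bco j m = 0 := bco_of_odd fun h' => by
        rw [← add_assoc, Nat.even_add_one] at h
        exact h h'
      rw [Finset.sum_Ico_succ_top (by omega), h0]
      ring
  · rw [if_neg h, if_neg (mt e.1 h), bco_of_odd (by convert h using 2; ring)]
    simp

theorem sum_inv_sqrt_le (m : ℕ) : ∑ k ∈ Finset.Ico 1 (m + 1), 1 / √(k : ℝ) ≤ 2 * √(m : ℝ) := by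
  induction m with
  | zero => simp
  | succ m ih =>
    rw [Finset.sum_Ico_succ_top (by omega)]
    have h1 : 0 < √((m + 1 : ℕ) : ℝ) := Real.sqrt_pos.2 (by positivity)
    have h0 : 0 ≤ √(m : ℝ) := Real.sqrt_nonneg _
    have h2 : √((m + 1 : ℕ) : ℝ) * √((m + 1 : ℕ) : ℝ) = m + 1 := by
      rw [Real.mul_self_sqrt (by positivity)]; push_cast; ring
    have h3 : √(m : ℝ) * √(m : ℝ) = m := Real.mul_self_sqrt (by positivity)
    have : 1 / √((m + 1 : ℕ) : ℝ) ≤ 2 * √((m + 1 : ℕ) : ℝ) - 2 * √(m : ℝ) := by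
      rw [div_le_iff₀ h1]
      nlinarith [sq_nonneg (√((m + 1 : ℕ) : ℝ) - √(m : ℝ))]
    linarith

/-- The rate m^(-1/2) is crude but stable under the recursion: the sum of k^(-1/2) up to m is at
most 2√m, and the factor 2/m restores m^(-1/2). It suffices for the absolute convergence of the sum
of `bco j m` / m. -/
theorem exists_bound_bco (j : ℕ) : ∃ C, 0 ≤ C ∧ ∀ m : ℕ, |bco j m| ≤ C * (1 / √(m : ℝ)) := by
  induction j with
  | zero =>
    refine ⟨2, by norm_num, fun m => ?_⟩
    rcases Nat.eq_zero_or_pos m with rfl | hm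
    · simp [bco_zero_right]
    have hm1 : (1 : ℝ) ≤ m := by exact_mod_cast hm
    have hs : √(m : ℝ) ≤ m := Real.sqrt_le_iff.2 ⟨by linarith, by nlinarith⟩
    have hs0 : 0 < √(m : ℝ) := Real.sqrt_pos.2 (by linarith)
    rw [bco, term_one_neg, altEven, pow_one, abs_div, abs_of_nonneg (by positivity : (0 : ℝ) ≤ m),
      mul_one_div]
    have : |2 * (if Even m then (-1 : ℝ) ^ (m / 2) else 0)| ≤ 2 := by
      split_ifs
      · rw [abs_mul, abs_neg_one_pow]; norm_num
      · norm_num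
    exact div_le_div₀ (by norm_num) this hs0 hs
  | succ j ih =>
    obtain ⟨C, hC, h⟩ := ih
    refine ⟨4 * C, by positivity, fun m => ?_⟩
    rcases Nat.eq_zero_or_pos m with rfl | hm
    · simp [bco_zero_right]
    have hm0 : (0 : ℝ) < m := by exact_mod_cast hm
    have hs0 : 0 < √(m : ℝ) := Real.sqrt_pos.2 hm0
    have h1 : |∑ k ∈ Finset.Ico 1 m, bco j k| ≤ C * (2 * √(m : ℝ)) := by
      refine (Finset.abs_sum_le_sum_abs _ _).trans ((Finset.sum_le_sum fun k _ => h k).trans ?_)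
      rw [← Finset.mul_sum]
      refine mul_le_mul_of_nonneg_left (le_trans ?_ (sum_inv_sqrt_le m)) hC
      exact Finset.sum_le_sum_of_subset_of_nonneg
        (Finset.Ico_subset_Ico_right (Nat.le_succ m)) fun _ _ _ => by positivity
    have h2 : |term ((-1) ^ (j + 1)) 1 1 m| ≤ 2 / m := by
      rw [term_parity]
      split_ifs
      · rw [abs_of_nonneg (by positivity)]
      · simp; positivity
    rw [bco, abs_mul]
    calc _ ≤ 2 / (m : ℝ) * (C * (2 * √(m : ℝ))) := by gcongr
      _ = 4 * C * (√(m : ℝ) / m) := by ring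
      _ = _ := by rw [Real.sqrt_div_self, one_div]

theorem exists_bound_bco' (j : ℕ) : ∃ C, 0 ≤ C ∧ ∀ m : ℕ, |bco j m| ≤ C := by
  obtain ⟨C, hC, h⟩ := exists_bound_bco j
  refine ⟨C, hC, fun m => (h m).trans (mul_le_of_le_one_right hC ?_)⟩
  rcases Nat.eq_zero_or_pos m with rfl | hm
  · simp
  · rw [one_div]
    exact inv_le_one_of_one_le₀ (Real.one_le_sqrt.2 (by exact_mod_cast hm))

theorem summable_bco_div (j : ℕ) : Summable fun m : ℕ => |bco j m| / m := by
  obtain ⟨C, hC, h⟩ := exists_bound_bco j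
  refine Summable.of_nonneg_of_le (fun m => by positivity) (fun m => ?_)
    ((Real.summable_one_div_nat_rpow.2 (by norm_num : (1 : ℝ) < 3 / 2)).mul_left C)
  rcases Nat.eq_zero_or_pos m with rfl | hm
  · simp
  have hm0 : (0 : ℝ) < m := by exact_mod_cast hm
  rw [show (3 / 2 : ℝ) = 1 / 2 + 1 by norm_num, Real.rpow_add_one hm0.ne', ← Real.sqrt_eq_rpow,
    div_le_iff₀ hm0]
  refine (h m).trans_eq ?_
  field_simp

/-! ### Power series with bounded coefficients in the unit disc -/

theorem summable_mul_pow {b : ℕ → ℂ} {C : ℝ} (hb : ∀ m, ‖b m‖ ≤ C) {x : ℂ} (hx : ‖x‖ < 1) :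
    Summable fun m => b m * x ^ m := by
  refine Summable.of_norm_bounded ((summable_geometric_of_lt_one (norm_nonneg x) hx).mul_left C)
    fun m => ?_
  rw [norm_mul, norm_pow]
  exact mul_le_mul_of_nonneg_right (hb m) (by positivity)

theorem summable_mul_nat_mul_pow {b : ℕ → ℂ} {C : ℝ} (hb : ∀ m, ‖b m‖ ≤ C) {x : ℂ}
    (hx : ‖x‖ < 1) : Summable fun m : ℕ => (m : ℂ) * b m * x ^ m := by
  have h := summable_pow_mul_geometric_of_norm_lt_one 1 (r := ‖x‖) (by simpa using hx)
  refine Summable.of_norm_bounded (h.mul_left C) fun m => ?_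
  rw [norm_mul, norm_mul, norm_pow, Complex.norm_natCast, pow_one]
  calc _ = ‖b m‖ * ((m : ℝ) * ‖x‖ ^ m) := by ring
    _ ≤ _ := mul_le_mul_of_nonneg_right (hb m) (by positivity)

theorem hasDerivAt_powerSeries {b : ℕ → ℂ} {C : ℝ} (hb : ∀ m, ‖b m‖ ≤ C) {x : ℂ} (hx : ‖x‖ < 1) :
    HasDerivAt (fun y => ∑' m, b m * y ^ m) (∑' m : ℕ, b m * (m * x ^ (m - 1))) x := by
  obtain ⟨ρ, hxρ, hρ⟩ := exists_between hx
  have hρ0 : 0 < ρ := (norm_nonneg x).trans_lt hxρ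
  have hu : Summable fun m : ℕ => C * (m * ρ ^ (m - 1)) := by
    have h := summable_pow_mul_geometric_of_norm_lt_one 1 (r := ρ)
      (by rwa [Real.norm_of_nonneg hρ0.le])
    refine ((h.div_const ρ).mul_left C).congr fun m => ?_
    rcases m with _ | m
    · simp
    · rw [pow_one, Nat.add_sub_cancel, pow_succ]
      field_simp
  refine hasDerivAt_tsum_of_isPreconnected (t := Metric.ball 0 ρ) (y₀ := x) hu Metric.isOpen_ball
    (convex_ball _ _).isPreconnected (fun m y _ => (hasDerivAt_pow m y).const_mul (b m))
    (fun m y hy => ?_) (by simpa using hxρ) (summable_mul_pow hb hx) (by simpa using hxρ)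
  rw [norm_mul, norm_mul, norm_pow, Complex.norm_natCast]
  have hC : 0 ≤ C := (norm_nonneg _).trans (hb 0)
  have hy' : ‖y‖ ≤ ρ := by simpa using (Metric.mem_ball.1 hy).le
  gcongr
  exact hb m

/-- The power series of the iterated integrals. -/
def iterInt (j : ℕ) (x : ℂ) : ℂ := ∑' m, (bco j m : ℂ) * x ^ m

theorem exists_norm_bound_bco (j : ℕ) : ∃ C : ℝ, ∀ m, ‖(bco j m : ℂ)‖ ≤ C := by
  obtain ⟨C, -, h⟩ := exists_bound_bco' j
  exact ⟨C, fun m => by rw [Complex.norm_real]; exact h m⟩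

theorem iterInt_zero_right (j : ℕ) : iterInt j 0 = 0 := by
  rw [iterInt, tsum_eq_single 0 fun m hm => by simp [hm]]
  simp [bco_zero_right]

theorem differentiableAt_iterInt (j : ℕ) {x : ℂ} (hx : ‖x‖ < 1) :
    DifferentiableAt ℂ (iterInt j) x := by
  obtain ⟨C, hC⟩ := exists_norm_bound_bco j
  exact (hasDerivAt_powerSeries hC hx).differentiableAt

/-- Multiply `bco_rec` by x^(m+1) and sum: the left side is (1 - x²) times the derivative. No
initial terms are lost in the shift by two, since the coefficient at index 1 has an empty inner sum.
-/
theorem hasDerivAt_iterInt_succ (j : ℕ) {x : ℂ} (hx : ‖x‖ < 1) :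
    HasDerivAt (iterInt (j + 1)) (2 * iterInt j x / (1 - x ^ 2)) x := by
  obtain ⟨C, hC⟩ := exists_norm_bound_bco (j + 1)
  obtain ⟨C', hC'⟩ := exists_norm_bound_bco j
  have h := hasDerivAt_powerSeries hC hx
  have hne : 1 - x ^ 2 ≠ 0 := fun h0 => by
    have : ‖x‖ ^ 2 = 1 := by rw [← norm_pow, ← sub_eq_zero.1 h0, norm_one]
    nlinarith [norm_nonneg x]
  refine h.congr_deriv ?_
  rw [eq_div_iff hne]
  have s1 : Summable fun m : ℕ => ((m : ℂ)) * (bco (j + 1) m : ℂ) * x ^ (m + 1) := by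
    refine ((summable_mul_nat_mul_pow hC hx).mul_right x).congr fun m => by ring
  have s2 : Summable fun m : ℕ => ((bco j (m + 1) : ℝ) : ℂ) * x ^ (m + 1) :=
    (summable_nat_add_iff 1).2 (summable_mul_pow hC' hx)
  have hrec : ∀ m : ℕ, ((m + 2 : ℕ) : ℂ) * (bco (j + 1) (m + 2) : ℂ) * x ^ (m + 1) =
      (m : ℂ) * (bco (j + 1) m : ℂ) * x ^ (m + 1) + 2 * ((bco j (m + 1) : ℂ) * x ^ (m + 1)) := by
    intro m
    have := congrArg (fun r : ℝ => (r : ℂ)) (bco_rec j m)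
    push_cast at this ⊢
    linear_combination x ^ (m + 1) * this
  have s3 : Summable fun m : ℕ => ((m + 2 : ℕ) : ℂ) * (bco (j + 1) (m + 2) : ℂ) * x ^ (m + 1) :=
    (s1.add (s2.mul_left 2)).congr fun m => (hrec m).symm
  have e1 : ∑' m : ℕ, (bco (j + 1) m : ℂ) * (m * x ^ (m - 1)) =
      ∑' m : ℕ, ((m + 2 : ℕ) : ℂ) * (bco (j + 1) (m + 2) : ℂ) * x ^ (m + 1) := by
    have z1 : bco (j + 1) 1 = 0 := by simp [bco]
    have hs : ∀ m : ℕ, ((bco (j + 1) (m + 2) : ℝ) : ℂ) * (((m + 2 : ℕ) : ℂ) * x ^ (m + 2 - 1)) =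
        ((m + 2 : ℕ) : ℂ) * (bco (j + 1) (m + 2) : ℂ) * x ^ (m + 1) := fun m => by
      rw [show m + 2 - 1 = m + 1 by omega]; ring
    have hsum : Summable fun m : ℕ => (bco (j + 1) m : ℂ) * (m * x ^ (m - 1)) :=
      (summable_nat_add_iff 2).1 (s3.congr fun m => (hs m).symm)
    rw [← hsum.sum_add_tsum_nat_add 2]
    rw [tsum_congr hs]
    simp [Finset.sum_range_succ, z1]
  have e2 : ∑' m : ℕ, ((m : ℂ)) * (bco (j + 1) m : ℂ) * x ^ (m + 1) =
      x ^ 2 * ∑' m : ℕ, (bco (j + 1) m : ℂ) * (m * x ^ (m - 1)) := by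
    rw [← tsum_mul_left]
    refine tsum_congr fun m => ?_
    rcases m with _ | m
    · simp
    · rw [Nat.add_sub_cancel]; ring
  have e3 : iterInt j x = ∑' m : ℕ, ((bco j (m + 1) : ℝ) : ℂ) * x ^ (m + 1) := by
    rw [iterInt, (summable_mul_pow hC' hx).tsum_eq_zero_add]
    simp [bco_zero_right]
  have e4 := s1.tsum_add (s2.mul_left 2)
  rw [← tsum_congr hrec, ← e1, e2, tsum_mul_left, ← e3] at e4
  linear_combination e4

theorem iterInt_zero {x : ℂ} (hx : ‖x‖ < 1) : iterInt 0 x = -Complex.log (1 + x ^ 2) := by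
  have h := Complex.hasSum_taylorSeries_neg_log (z := -x ^ 2)
    (by rw [norm_neg, norm_pow]; exact pow_lt_one₀ (norm_nonneg x) hx two_ne_zero)
  rw [sub_neg_eq_add] at h
  rw [← h.tsum_eq, iterInt]
  have hinj : Function.Injective fun k : ℕ => 2 * k := fun a b h => by
    simpa using h
  rw [← hinj.tsum_eq]
  · refine tsum_congr fun k => ?_
    rw [bco, term_one_neg, altEven, if_pos (even_two_mul k), Nat.mul_div_cancel_left k two_pos,
      neg_pow (x ^ 2), ← pow_mul]
    push_cast
    rcases Nat.eq_zero_or_pos k with rfl | hk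
    · simp
    · have : (k : ℂ) ≠ 0 := by exact_mod_cast hk.ne'
      field_simp
  · intro m hm
    by_contra hm'
    refine hm ?_
    have : ¬ Even m := fun ⟨k, hk⟩ => hm' ⟨k, by simp only; omega⟩
    simp [bco_of_odd (j := 0) (m := m) (by simpa using this)]

/-! ### The functional equation of the iterated integrals -/

/-- The polylogarithm-like series `∑ quad n * z^n / n^(j+1)`. -/
def polySer (j : ℕ) (z : ℂ) : ℂ := ∑' n : ℕ, ((quad n / (n : ℝ) ^ (j + 1) : ℝ) : ℂ) * z ^ n

theorem abs_quad_le (n : ℕ) : |quad n| ≤ 4 := by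
  have h1 : |alt n| ≤ 1 := by rw [alt, abs_neg_one_pow]
  have h2 : |altEven n| ≤ 1 := by
    rw [altEven]; split_ifs
    · rw [abs_neg_one_pow]
    · simp
  rw [quad]
  rw [abs_le] at *
  constructor <;> linarith [h1.1, h1.2, h2.1, h2.2]

theorem bounded_quad : ∃ B, ∀ n, 1 ≤ n → |quad n| ≤ B := ⟨4, fun n _ => abs_quad_le n⟩

theorem norm_quad_div_le (j n : ℕ) : ‖((quad n / (n : ℝ) ^ (j + 1) : ℝ) : ℂ)‖ ≤ 4 := by
  rw [Complex.norm_real, Real.norm_eq_abs]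
  rcases Nat.eq_zero_or_pos n with rfl | hn
  · simp
  · have : (1 : ℝ) ≤ (n : ℝ) ^ (j + 1) := one_le_pow₀ (by exact_mod_cast hn)
    rw [abs_div, abs_of_nonneg (by positivity : (0 : ℝ) ≤ (n : ℝ) ^ (j + 1)),
      div_le_iff₀ (by positivity)]
    nlinarith [abs_quad_le n]

theorem hasDerivAt_polySer_succ (j : ℕ) {z : ℂ} (hz : ‖z‖ < 1) (hz0 : z ≠ 0) :
    HasDerivAt (polySer (j + 1)) (polySer j z / z) z := by
  refine (hasDerivAt_powerSeries (norm_quad_div_le (j + 1)) hz).congr_deriv ?_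
  rw [eq_div_iff hz0, polySer, ← tsum_mul_right]
  refine tsum_congr fun n => ?_
  rcases Nat.eq_zero_or_pos n with rfl | hn
  · simp
  · obtain ⟨n, rfl⟩ : ∃ k, n = k + 1 := ⟨n - 1, by omega⟩
    have : ((n + 1 : ℕ) : ℂ) ≠ 0 := by exact_mod_cast hn.ne'
    rw [Nat.add_sub_cancel]
    push_cast at this ⊢
    field_simp
    ring

theorem summable_quad_div (j : ℕ) : Summable fun n : ℕ => quad n / (n : ℝ) ^ (j + 2) :=
  summable_div_pow bounded_quad (Nat.le_add_left 2 j)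

theorem continuousOn_polySer_succ (j : ℕ) :
    ContinuousOn (polySer (j + 1)) (Metric.closedBall 0 1) := by
  refine continuousOn_tsum (fun n => by fun_prop) (summable_quad_div j).abs fun n z hz => ?_
  rw [norm_mul, Complex.norm_real, norm_pow, Real.norm_eq_abs]
  exact mul_le_of_le_one_right (abs_nonneg _)
    (pow_le_one₀ (norm_nonneg _) (by simpa using hz))

/-- At exponent 1 the coefficient of `quad` is 2(-1)^n/n minus `bco 0 n`, so the series is a
combination of two logarithmic series. -/
theorem polySer_zero {z : ℂ} (hz : ‖z‖ < 1) :
    polySer 0 z = -2 * Complex.log (1 + z) + Complex.log (1 + z ^ 2) := by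
  have h1 := (Complex.hasSum_taylorSeries_neg_log (z := -z) (by rwa [norm_neg])).mul_left 2
  obtain ⟨C, hC⟩ := exists_norm_bound_bco 0
  have h2 := h1.sub (summable_mul_pow hC hz).hasSum
  change HasSum _ (_ - iterInt 0 z) at h2
  rw [iterInt_zero hz] at h2
  have h3 : 2 * -Complex.log (1 - -z) - -Complex.log (1 + z ^ 2) =
      -2 * Complex.log (1 + z) + Complex.log (1 + z ^ 2) := by
    simp only [sub_neg_eq_add]; ring
  rw [← h3, ← h2.tsum_eq, polySer]
  refine tsum_congr fun n => ?_
  rw [bco, term_one_neg, quad, alt, neg_pow z]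
  push_cast
  ring

/-- Abel's limit theorem carries the logarithmic series to the boundary point 1. -/
theorem LSer_alt_one : LSer alt 1 = -Real.log 2 := by
  have h := bddPartial_alt.tendsto_LSer le_rfl
  have h' : Tendsto (fun N => ∑ n ∈ Finset.range N, alt n / (n : ℝ) ^ 1) atTop
      (𝓝 (LSer alt 1)) := h.congr fun N => sum_Ico_one_eq_sum_range (by simp) N
  have habel := Real.tendsto_tsum_powerSeries_nhdsWithin_lt h'
  have hlog : Tendsto (fun x : ℝ => -Real.log (1 + x)) (𝓝[<] 1) (𝓝 (-Real.log (1 + 1))) := by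
    refine Tendsto.mono_left ?_ nhdsWithin_le_nhds
    refine (Real.continuousAt_log (by norm_num)).neg.tendsto.comp
      (Continuous.tendsto (by fun_prop : Continuous fun x : ℝ => 1 + x) 1)
  rw [show (2 : ℝ) = 1 + 1 by norm_num]
  refine tendsto_nhds_unique habel (hlog.congr' ?_)
  filter_upwards [Ioo_mem_nhdsLT (show (0 : ℝ) < 1 by norm_num)] with x hx
  have hs := Real.hasSum_pow_div_log_of_abs_lt_one (x := -x)
    (by rw [abs_neg, abs_of_pos hx.1]; exact hx.2)
  rw [sub_neg_eq_add] at hs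
  rw [← hs.tsum_eq]
  have hsum : Summable fun n : ℕ => alt n / (n : ℝ) ^ 1 * x ^ n := by
    refine (summable_nat_add_iff 1).1 (hs.summable.congr fun n => ?_)
    rw [alt, neg_pow x]
    push_cast
    ring
  rw [hsum.tsum_eq_zero_add]
  simp only [alt, pow_one, Nat.cast_zero, div_zero, zero_mul, zero_add]
  refine tsum_congr fun n => ?_
  rw [neg_pow x]
  push_cast
  ring

theorem LSer_quad_one : LSer quad 1 = -Real.log 2 := by
  have := LSer_quad 0
  rw [zero_add, LSer_alt_one] at this
  rw [this]; norm_num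

/-! ### The Cayley transform and the functional equation -/

theorem norm_cayley_lt_one {z : ℂ} (hz : 0 < z.re) : ‖(z - 1) / (z + 1)‖ < 1 := by
  have h1 : z + 1 ≠ 0 := fun h => by
    have := congrArg Complex.re h
    simp at this; linarith
  rw [norm_div, div_lt_one (norm_pos_iff.2 h1)]
  refine lt_of_pow_lt_pow_left₀ 2 (norm_nonneg _) ?_
  rw [Complex.sq_norm, Complex.sq_norm, Complex.normSq_apply, Complex.normSq_apply]
  simp
  nlinarith

theorem one_add_ne_zero_of_re_pos {z : ℂ} (hz : 0 < z.re) : z + 1 ≠ 0 := fun h => by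
  have := congrArg Complex.re h
  simp at this; linarith

theorem hasDerivAt_cayley {z : ℂ} (hz : 0 < z.re) :
    HasDerivAt (fun z : ℂ => (z - 1) / (z + 1)) (2 / (z + 1) ^ 2) z := by
  have h := ((hasDerivAt_id z).sub_const 1).fun_div ((hasDerivAt_id z).add_const 1)
    (one_add_ne_zero_of_re_pos hz)
  refine h.congr_deriv ?_
  simp
  ring

theorem one_add_sq_mem_slitPlane {z : ℂ} (hz : 0 < z.re) : 1 + z ^ 2 ∈ Complex.slitPlane := by
  rw [Complex.mem_slitPlane_iff]
  rcases eq_or_ne z.im 0 with h | h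
  · left
    rw [pow_two]; simp [h]; positivity
  · right
    rw [pow_two]; simp
    intro h'
    exact mul_ne_zero hz.ne' h (by linarith)

theorem one_add_sq_mem_slitPlane_of_norm_lt {x : ℂ} (hx : ‖x‖ < 1) :
    1 + x ^ 2 ∈ Complex.slitPlane := by
  rw [Complex.mem_slitPlane_iff]
  left
  have h1 : ‖x ^ 2‖ < 1 := by rw [norm_pow]; exact pow_lt_one₀ (norm_nonneg x) hx two_ne_zero
  have h2 := (Complex.abs_re_le_norm (x ^ 2)).trans_lt h1
  rw [Complex.add_re, Complex.one_re]
  linarith [(abs_lt.1 h2).1]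

theorem convex_re_pos : Convex ℝ {z : ℂ | 0 < z.re} := convex_halfSpace_re_gt 0

theorem isOpen_re_pos : IsOpen {z : ℂ | 0 < z.re} := isOpen_lt continuous_const Complex.continuous_re

/-- Exponentiated, this is 1 + x² = 2(1 + z²)/(1 + z)². Branches of the logarithm are controlled by
showing that the difference has zero derivative on the connected right half plane and comparing
values at z = 1. -/
theorem log_one_add_cayley_sq {z : ℂ} (hz : 0 < z.re) :
    Complex.log (1 + ((z - 1) / (z + 1)) ^ 2) =
      Complex.log 2 + Complex.log (1 + z ^ 2) - 2 * Complex.log (1 + z) := by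
  have hd : ∀ w ∈ {z : ℂ | 0 < z.re}, HasDerivAt (fun z : ℂ =>
      Complex.log (1 + ((z - 1) / (z + 1)) ^ 2) - Complex.log (1 + z ^ 2) +
        2 * Complex.log (1 + z)) 0 w := fun w hw => by
    have hw1 := one_add_ne_zero_of_re_pos hw
    have a1 := one_add_sq_mem_slitPlane_of_norm_lt (norm_cayley_lt_one hw)
    have a2 := one_add_sq_mem_slitPlane hw
    have a3 : 1 + w ∈ Complex.slitPlane := by
      rw [Complex.mem_slitPlane_iff]; left
      have : (0 : ℝ) < w.re := hw
      simp; linarith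
    have h1 := (((hasDerivAt_cayley hw).fun_pow 2).const_add 1).clog a1
    have h2 := (((hasDerivAt_id w).fun_pow 2).const_add 1).clog a2
    have h3 := (((hasDerivAt_id w).const_add 1).clog a3).const_mul 2
    refine ((h1.sub h2).add h3).congr_deriv ?_
    have b1 := Complex.slitPlane_ne_zero a1
    have b2 := Complex.slitPlane_ne_zero a2
    have b3 := Complex.slitPlane_ne_zero a3
    have e : 1 + ((w - 1) / (w + 1)) ^ 2 = 2 * (1 + w ^ 2) / (w + 1) ^ 2 := by
      field_simp; ring
    simp only [id, Nat.add_one_sub_one, pow_one, Nat.cast_ofNat]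
    rw [e, add_comm 1 w]
    have h4 : (2 : ℂ) * ((w - 1) / (w + 1)) * (2 / (w + 1) ^ 2) / (2 * (1 + w ^ 2) / (w + 1) ^ 2) =
        2 * (w - 1) / ((w + 1) * (1 + w ^ 2)) := by
      field_simp
    rw [h4]
    field_simp
    ring
  have hc := isOpen_re_pos.is_const_of_deriv_eq_zero convex_re_pos.isPreconnected
    (fun w hw => (hd w hw).differentiableAt.differentiableWithinAt)
    (fun w hw => (hd w hw).deriv) hz (show (1 : ℂ) ∈ {z : ℂ | 0 < z.re} by simp)
  simp only [sub_self, zero_div] at hc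
  norm_num at hc
  linear_combination hc

/-- The difference of the two sides of the functional equation. -/
def feqDiff (j : ℕ) (z : ℂ) : ℂ :=
  iterInt j ((z - 1) / (z + 1)) + polySer j z -
    ∑ k ∈ Finset.range (j + 1), Complex.log z ^ k / (k.factorial : ℂ) *
      (LSer quad (j - k + 1) : ℂ)

theorem hasDerivAt_log_pow_sum (j : ℕ) (D : ℕ → ℂ) {z : ℂ} (hz : z ∈ Complex.slitPlane) :
    HasDerivAt (fun z => ∑ k ∈ Finset.range (j + 2), Complex.log z ^ k / (k.factorial : ℂ) *
      D (j + 1 - k)) ((∑ k ∈ Finset.range (j + 1), Complex.log z ^ k / (k.factorial : ℂ) *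
      D (j - k)) / z) z := by
  have h := HasDerivAt.fun_sum (u := Finset.range (j + 2)) fun k _ =>
    ((((Complex.hasDerivAt_log hz).fun_pow k).div_const (k.factorial : ℂ)).mul_const
      (D (j + 1 - k)))
  refine h.congr_deriv ?_
  rw [Finset.sum_range_succ']
  simp only [Nat.cast_zero, zero_mul, zero_div, add_zero]
  rw [Finset.sum_div]
  refine Finset.sum_congr rfl fun k _ => ?_
  have hk : ((k + 1 : ℕ) : ℂ) ≠ 0 := Nat.cast_ne_zero.2 (Nat.succ_ne_zero k)
  have hf : (k.factorial : ℂ) ≠ 0 := Nat.cast_ne_zero.2 k.factorial_ne_zero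
  rw [Nat.add_sub_cancel, Nat.add_sub_add_right, Nat.factorial_succ]
  push_cast at hk ⊢
  have hz0 := Complex.slitPlane_ne_zero hz
  field_simp

/-- For x = (z - 1)/(z + 1) one has 1 - x² = 4z/(z + 1)², hence 2 dx/(1 - x²) = dz/z. The
polylogarithm-like series and the polynomials in log z obey the same rule for z d/dz. -/
theorem hasDerivAt_feqDiff_succ (j : ℕ) {z : ℂ} (hz : ‖z‖ < 1) (hre : 0 < z.re) :
    HasDerivAt (feqDiff (j + 1)) (feqDiff j z / z) z := by
  have hsl : z ∈ Complex.slitPlane := Complex.mem_slitPlane_iff.2 (Or.inl hre)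
  have hz0 := Complex.slitPlane_ne_zero hsl
  have hz1 := one_add_ne_zero_of_re_pos hre
  have h1 := (hasDerivAt_iterInt_succ j (norm_cayley_lt_one hre)).comp z (hasDerivAt_cayley hre)
  have h2 := hasDerivAt_polySer_succ j hz hz0
  have h3 := hasDerivAt_log_pow_sum j (fun p => (LSer quad (p + 1) : ℂ)) hsl
  refine ((h1.add h2).sub h3).congr_deriv ?_
  rw [feqDiff]
  have e : 1 - ((z - 1) / (z + 1)) ^ 2 = 4 * z / (z + 1) ^ 2 := by
    field_simp; ring
  rw [e]
  field_simp
  ring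

theorem continuousOn_feqDiff_succ (j : ℕ) :
    ContinuousOn (feqDiff (j + 1)) (Metric.closedBall 0 1 ∩ {z | 0 < z.re}) := by
  refine ContinuousOn.sub (ContinuousOn.add (fun z hz => ?_)
    ((continuousOn_polySer_succ j).mono Set.inter_subset_left)) ?_
  · exact (ContinuousAt.comp (f := fun z : ℂ => (z - 1) / (z + 1))
      (differentiableAt_iterInt (j + 1) (norm_cayley_lt_one hz.2)).continuousAt
      (hasDerivAt_cayley hz.2).continuousAt).continuousWithinAt
  · have hl : ContinuousOn Complex.log (Metric.closedBall 0 1 ∩ {z | 0 < z.re}) := fun z hz =>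
      (Complex.differentiableAt_log
        (Complex.mem_slitPlane_iff.2 (Or.inl hz.2))).continuousAt.continuousWithinAt
    exact continuousOn_finsetSum _ fun k _ => ((hl.pow k).div_const _).mul_const _

/-- This fixes the constant of integration: at z = 1 the iterated integral and all positive powers
of log z vanish, and the term with k = 0 is the value of the series. -/
theorem feqDiff_succ_one (j : ℕ) : feqDiff (j + 1) 1 = 0 := by
  have h : polySer (j + 1) 1 = (LSer quad (j + 2) : ℂ) := by
    rw [polySer, LSer_eq_tsum bounded_quad (Nat.le_add_left 2 j), Complex.ofReal_tsum]
    exact tsum_congr fun n => by simp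
  rw [feqDiff, sub_self, zero_div, iterInt_zero_right, h, Finset.sum_range_succ']
  simp

theorem feqDiff_zero {z : ℂ} (hz : ‖z‖ < 1) (hre : 0 < z.re) : feqDiff 0 z = 0 := by
  rw [feqDiff, iterInt_zero (norm_cayley_lt_one hre), polySer_zero hz, log_one_add_cayley_sq hre]
  simp [LSer_quad_one]
  ring

theorem feqDiff_eq_zero_of_lt (j : ℕ) : ∀ z : ℂ, ‖z‖ < 1 → 0 < z.re → feqDiff j z = 0 := by
  induction j with
  | zero => exact fun z => feqDiff_zero
  | succ j ih =>
    intro z hz hre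
    set U : Set ℂ := Metric.ball 0 1 ∩ {z | 0 < z.re} with hU
    have hUo : IsOpen U := Metric.isOpen_ball.inter isOpen_re_pos
    have hUc : Convex ℝ U := (convex_ball _ _).inter convex_re_pos
    have hd : ∀ w ∈ U, HasDerivAt (feqDiff (j + 1)) 0 w := fun w hw => by
      have hw1 : ‖w‖ < 1 := by simpa using hw.1
      have := hasDerivAt_feqDiff_succ j hw1 hw.2
      rwa [ih w hw1 hw.2, zero_div] at this
    have hconst : ∀ w ∈ U, feqDiff (j + 1) w = feqDiff (j + 1) z := fun w hw =>
      hUo.is_const_of_deriv_eq_zero hUc.isPreconnected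
        (fun w hw => (hd w hw).differentiableAt.differentiableWithinAt)
        (fun w hw => (hd w hw).deriv) hw ⟨by simpa using hz, hre⟩
    -- The base point 1 lies on the boundary of the half disc, so the constant is identified by a
    -- radial limit.
    have hpath : Tendsto (fun r : ℝ => (r : ℂ)) (𝓝[<] 1)
        (𝓝[Metric.closedBall 0 1 ∩ {z | 0 < z.re}] 1) := by
      refine tendsto_nhdsWithin_iff.2 ⟨?_, ?_⟩
      · exact (Complex.continuous_ofReal.tendsto' 1 1 (by simp)).mono_left nhdsWithin_le_nhds
      · filter_upwards [Ioo_mem_nhdsLT (show (0 : ℝ) < 1 by norm_num)] with r hr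
        exact ⟨by simp [abs_of_pos hr.1, hr.2.le], by simpa using hr.1⟩
    have h1 := (continuousOn_feqDiff_succ j 1 (by simp)).tendsto.comp hpath
    rw [feqDiff_succ_one] at h1
    refine tendsto_nhds_unique (tendsto_const_nhds.congr' ?_) h1
    filter_upwards [Ioo_mem_nhdsLT (show (0 : ℝ) < 1 by norm_num)] with r hr
    exact (hconst r ⟨by simp [abs_of_pos hr.1, hr.2], by simpa using hr.1⟩).symm

/-- Radial limits extend the equation to the unit circle. From index j + 1 on the series converges
absolutely there, which gives the continuity needed. -/
theorem feqDiff_succ_eq_zero (j : ℕ) {z : ℂ} (hz : ‖z‖ ≤ 1) (hre : 0 < z.re) :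
    feqDiff (j + 1) z = 0 := by
  have hre' : ∀ r : ℝ, ((r : ℂ) * z).re = r * z.re := fun r => by simp
  have hpath : Tendsto (fun r : ℝ => (r : ℂ) * z) (𝓝[<] 1)
      (𝓝[Metric.closedBall 0 1 ∩ {z | 0 < z.re}] z) := by
    refine tendsto_nhdsWithin_iff.2 ⟨?_, ?_⟩
    · exact ((by fun_prop : Continuous fun r : ℝ => (r : ℂ) * z).tendsto' 1 z (by simp)).mono_left
        nhdsWithin_le_nhds
    · filter_upwards [Ioo_mem_nhdsLT (show (0 : ℝ) < 1 by norm_num)] with r hr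
      refine ⟨?_, ?_⟩
      · rw [mem_closedBall_zero_iff, norm_mul, Complex.norm_real, Real.norm_of_nonneg hr.1.le]
        exact mul_le_one₀ hr.2.le (norm_nonneg _) hz
      · rw [Set.mem_ofPred_eq, hre']
        exact mul_pos hr.1 hre
  have h1 := (continuousOn_feqDiff_succ j z ⟨by simpa using hz, hre⟩).tendsto.comp hpath
  refine tendsto_nhds_unique h1 (tendsto_const_nhds.congr' ?_)
  filter_upwards [Ioo_mem_nhdsLT (show (0 : ℝ) < 1 by norm_num)] with r hr
  refine (feqDiff_eq_zero_of_lt (j + 1) _ ?_ ?_).symm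
  · rw [norm_mul, Complex.norm_real, Real.norm_of_nonneg hr.1.le]
    nlinarith [norm_nonneg z, hr.1, hr.2]
  · rw [hre']
    exact mul_pos hr.1 hre

/-! ### Restriction to the unit circle -/

theorem exp_cayley {θ : ℝ} (h0 : Real.cos (θ / 2) ≠ 0) :
    (Complex.exp (θ * Complex.I) - 1) / (Complex.exp (θ * Complex.I) + 1) =
      Complex.I * (Real.tan (θ / 2) : ℂ) := by
  have hc : Complex.cos ((θ : ℂ) / 2) ≠ 0 := by
    have : Complex.cos ((θ : ℂ) / 2) = ((Real.cos (θ / 2) : ℝ) : ℂ) := by push_cast; rfl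
    rw [this]; exact_mod_cast h0
  have e : Complex.exp (θ * Complex.I) =
      (Complex.cos ((θ : ℂ) / 2) + Complex.sin ((θ : ℂ) / 2) * Complex.I) ^ 2 := by
    rw [← Complex.exp_mul_I, ← Complex.exp_nat_mul]
    congr 1
    push_cast
    ring
  have hs := Complex.sin_sq_add_cos_sq ((θ : ℂ) / 2)
  have e1 : Complex.exp (θ * Complex.I) - 1 = 2 * Complex.I * Complex.sin ((θ : ℂ) / 2) *
      (Complex.cos ((θ : ℂ) / 2) + Complex.sin ((θ : ℂ) / 2) * Complex.I) := by
    rw [e]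
    linear_combination (-Complex.sin ((θ : ℂ) / 2) ^ 2) * Complex.I_sq + hs
  have e2 : Complex.exp (θ * Complex.I) + 1 = 2 * Complex.cos ((θ : ℂ) / 2) *
      (Complex.cos ((θ : ℂ) / 2) + Complex.sin ((θ : ℂ) / 2) * Complex.I) := by
    rw [e]
    linear_combination (Complex.sin ((θ : ℂ) / 2) ^ 2) * Complex.I_sq - hs
  have hne : Complex.cos ((θ : ℂ) / 2) + Complex.sin ((θ : ℂ) / 2) * Complex.I ≠ 0 := by
    rw [← Complex.exp_mul_I]; exact Complex.exp_ne_zero _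
  rw [e1, e2]
  push_cast
  rw [Complex.tan_eq_sin_div_cos, mul_div_mul_right _ _ hne]
  field_simp

/-- The iterated integral on the imaginary axis as a Fourier series plus a polynomial. -/
theorem tsum_bco_mul_tan_pow {l : ℕ} (hl : 1 ≤ l) {θ : ℝ} (h0 : 0 ≤ θ) (h1 : θ < Real.pi / 2) :
    ∑' m : ℕ, (Complex.I ^ m).re * bco (2 * l) m * Real.tan (θ / 2) ^ m =
      ∑' n : ℕ, quad n / (n : ℝ) ^ (2 * l + 1) * (1 - Real.cos (n * θ)) +
        ∑ q ∈ Finset.Ico 1 (2 * l + 1), (Complex.I ^ q).re *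
          (θ ^ q / (q.factorial : ℝ)) * LSer quad (2 * l - q + 1) := by
  have hpi := Real.pi_pos
  obtain ⟨j, hj⟩ : ∃ j, 2 * l = j + 1 := ⟨2 * l - 1, by omega⟩
  rw [hj]
  have hre : 0 < (Complex.exp (θ * Complex.I)).re := by
    rw [Complex.exp_ofReal_mul_I_re]
    exact Real.cos_pos_of_mem_Ioo ⟨by linarith, h1⟩
  have hfe := feqDiff_succ_eq_zero j (Complex.norm_exp_ofReal_mul_I θ).le hre
  rw [feqDiff, exp_cayley (Real.cos_pos_of_mem_Ioo ⟨by linarith, by linarith⟩).ne',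
    Complex.log_exp (by simp; linarith) (by simp; linarith), Finset.sum_range_succ'] at hfe
  have hx : ‖Complex.I * (Real.tan (θ / 2) : ℂ)‖ < 1 := by
    rw [← exp_cayley (Real.cos_pos_of_mem_Ioo ⟨by linarith, by linarith⟩).ne']
    exact norm_cayley_lt_one hre
  obtain ⟨C, hC⟩ := exists_norm_bound_bco (j + 1)
  have a1 : (iterInt (j + 1) (Complex.I * (Real.tan (θ / 2) : ℂ))).re =
      ∑' m : ℕ, (Complex.I ^ m).re * bco (j + 1) m * Real.tan (θ / 2) ^ m := by
    rw [iterInt, Complex.re_tsum (summable_mul_pow hC hx)]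
    refine tsum_congr fun m => ?_
    rw [mul_pow, ← Complex.ofReal_pow, Complex.re_ofReal_mul, Complex.re_mul_ofReal]
    ring
  have hsum : Summable fun n : ℕ =>
      quad n / (n : ℝ) ^ (j + 1 + 1) * Real.cos (n * θ) := by
    refine Summable.of_norm_bounded (summable_quad_div j).abs fun n => ?_
    rw [norm_mul, Real.norm_eq_abs, Real.norm_eq_abs]
    exact mul_le_of_le_one_right (abs_nonneg _) (Real.abs_cos_le_one _)
  have a2 : (polySer (j + 1) (Complex.exp (θ * Complex.I))).re =
      ∑' n : ℕ, quad n / (n : ℝ) ^ (j + 1 + 1) * Real.cos (n * θ) := by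
    rw [polySer, Complex.re_tsum]
    · refine tsum_congr fun n => ?_
      rw [← Complex.exp_nat_mul, Complex.re_ofReal_mul,
        show (n : ℂ) * (θ * Complex.I) = ((n * θ : ℝ) : ℂ) * Complex.I by push_cast; ring,
        Complex.exp_ofReal_mul_I_re]
    · refine Summable.of_norm_bounded (summable_quad_div j).abs fun n => ?_
      rw [norm_mul, norm_pow, Complex.norm_exp_ofReal_mul_I, one_pow, mul_one, Complex.norm_real,
        Real.norm_eq_abs]
  have a3 : ∑' n : ℕ, quad n / (n : ℝ) ^ (j + 1 + 1) * (1 - Real.cos (n * θ)) =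
      LSer quad (j + 2) - ∑' n : ℕ, quad n / (n : ℝ) ^ (j + 1 + 1) * Real.cos (n * θ) := by
    rw [LSer_eq_tsum bounded_quad (Nat.le_add_left 2 j), ← (summable_quad_div j).tsum_sub hsum]
    exact tsum_congr fun n => by ring
  have a4 : (∑ k ∈ Finset.range (j + 1), (θ * Complex.I) ^ (k + 1) / ((k + 1).factorial : ℂ) *
      (LSer quad (j + 1 - (k + 1) + 1) : ℂ)).re = ∑ q ∈ Finset.Ico 1 (j + 1 + 1),
        (Complex.I ^ q).re * (θ ^ q / (q.factorial : ℝ)) * LSer quad (j + 1 - q + 1) := by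
    rw [Complex.re_sum, Finset.sum_Ico_eq_sum_range]
    refine Finset.sum_congr (by simp) fun k _ => ?_
    rw [Complex.re_mul_ofReal, add_comm 1 k, mul_pow, ← Complex.ofReal_pow, ← Complex.ofReal_natCast,
      Complex.div_ofReal_re, Complex.re_ofReal_mul]
    ring
  have h := congrArg Complex.re hfe
  rw [Complex.sub_re, Complex.add_re, Complex.add_re, a1, a2, a4] at h
  simp at h
  rw [a3]
  linarith

section

open MeasureTheory Set

/-! ### Integrals against `1 / sin` -/

/-- Jordan's inequality sin θ ≥ 2θ/π shows that linear vanishing of f at 0 compensates the pole of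
1/sin θ. -/
theorem integrableOn_div_sin {f : ℝ → ℝ} (hf : Continuous f) {C : ℝ}
    (hC : ∀ θ ∈ Ioo 0 (Real.pi / 2), |f θ| ≤ C * θ) :
    IntegrableOn (fun θ => f θ / Real.sin θ) (Ioo 0 (Real.pi / 2)) ∧
      |∫ θ in Ioo 0 (Real.pi / 2), f θ / Real.sin θ| ≤ C * (Real.pi / 2) * (Real.pi / 2) := by
  have hpi := Real.pi_pos
  have hb : ∀ θ ∈ Ioo 0 (Real.pi / 2), ‖f θ / Real.sin θ‖ ≤ C * (Real.pi / 2) := fun θ hθ => by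
    have h1 : 2 / Real.pi * θ ≤ Real.sin θ := Real.mul_le_sin hθ.1.le hθ.2.le
    have h2 : 0 < Real.sin θ := lt_of_lt_of_le (mul_pos (by positivity) hθ.1) h1
    have hC0 : 0 ≤ C := by
      have := (abs_nonneg _).trans (hC θ hθ)
      exact nonneg_of_mul_nonneg_left this hθ.1
    rw [Real.norm_eq_abs, abs_div, abs_of_pos h2, div_le_iff₀ h2]
    calc |f θ| ≤ C * θ := hC θ hθ
      _ = C * (Real.pi / 2) * (2 / Real.pi * θ) := by field_simp
      _ ≤ _ := mul_le_mul_of_nonneg_left h1 (by positivity)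
  have hfin : volume (Ioo 0 (Real.pi / 2)) < ⊤ := measure_Ioo_lt_top
  constructor
  · refine Measure.integrableOn_of_bounded (M := C * (Real.pi / 2)) hfin.ne ?_ ?_
    · exact (hf.measurable.div Real.measurable_sin).aestronglyMeasurable
    · exact (ae_restrict_iff' measurableSet_Ioo).2 (Eventually.of_forall hb)
  · have := norm_setIntegral_le_of_norm_le_const (μ := volume) hfin hb
    rwa [Real.norm_eq_abs, Real.volume_real_Ioo_of_le (by positivity), sub_zero] at this

theorem setIntegral_Ioo_eq_sub {E : Type*} [NormedAddCommGroup E] [NormedSpace ℝ E]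
    [CompleteSpace E] {f f' : ℝ → E}
    (hd : ∀ θ ∈ Icc 0 (Real.pi / 2), HasDerivAt f (f' θ) θ)
    (hc : ContinuousOn f' (Icc 0 (Real.pi / 2))) :
    ∫ θ in Ioo 0 (Real.pi / 2), f' θ = f (Real.pi / 2) - f 0 := by
  have h0 : 0 ≤ Real.pi / 2 := by positivity
  rw [← integral_Ioc_eq_integral_Ioo, ← intervalIntegral.integral_of_le h0]
  refine intervalIntegral.integral_eq_sub_of_hasDerivAt (fun θ hθ => hd θ ?_)
    (ContinuousOn.intervalIntegrable ?_)
  · rwa [uIcc_of_le h0] at hθ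
  · rwa [uIcc_of_le h0]

theorem cos_half_pos {θ : ℝ} (hθ : θ ∈ Icc 0 (Real.pi / 2)) : 0 < Real.cos (θ / 2) :=
  Real.cos_pos_of_mem_Ioo ⟨by linarith [hθ.1, Real.pi_pos], by linarith [hθ.2, Real.pi_pos]⟩

theorem sin_pos_of_mem {θ : ℝ} (hθ : θ ∈ Ioo 0 (Real.pi / 2)) : 0 < Real.sin θ :=
  Real.sin_pos_of_pos_of_lt_pi hθ.1 (by linarith [hθ.2, Real.pi_pos])

/-- This is dt/t = dθ/sin θ for t = tan(θ/2), in a form that stays continuous up to the endpoints.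
-/
theorem tan_pow_div_sin {m : ℕ} {θ : ℝ} (hθ : θ ∈ Ioo 0 (Real.pi / 2)) :
    Real.tan (θ / 2) ^ (m + 1) / Real.sin θ =
      Real.tan (θ / 2) ^ m * (1 / Real.cos (θ / 2) ^ 2 * (1 / 2)) := by
  have hc := (cos_half_pos (Ioo_subset_Icc_self hθ)).ne'
  have hs : Real.sin θ = 2 * Real.sin (θ / 2) * Real.cos (θ / 2) := by
    rw [← Real.sin_two_mul]; ring_nf
  have hs0 : Real.sin (θ / 2) ≠ 0 := fun h => by
    have := sin_pos_of_mem hθ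
    rw [hs, h] at this
    simp at this
  rw [hs, pow_succ, mul_div_assoc, Real.tan_eq_sin_div_cos]
  field_simp

theorem continuousOn_tan_half :
    ContinuousOn (fun θ : ℝ => Real.tan (θ / 2)) (Icc 0 (Real.pi / 2)) := fun θ hθ =>
  (ContinuousAt.comp (f := fun θ : ℝ => θ / 2)
    (Real.continuousAt_tan.2 (cos_half_pos hθ).ne') (by fun_prop)).continuousWithinAt

theorem continuousOn_tan_half_pow (m : ℕ) :
    ContinuousOn (fun θ : ℝ => Real.tan (θ / 2) ^ m * (1 / Real.cos (θ / 2) ^ 2 * (1 / 2)))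
      (Icc 0 (Real.pi / 2)) := by
  refine (continuousOn_tan_half.pow m).mul (ContinuousOn.mul (ContinuousOn.div continuousOn_const
    (by fun_prop) fun θ hθ => ?_) continuousOn_const)
  exact pow_ne_zero 2 (cos_half_pos hθ).ne'

theorem integrableOn_tan_half_pow (m : ℕ) :
    IntegrableOn (fun θ => Real.tan (θ / 2) ^ (m + 1) / Real.sin θ) (Ioo 0 (Real.pi / 2)) :=
  (((continuousOn_tan_half_pow m).integrableOn_Icc).mono_set Ioo_subset_Icc_self).congr_fun
    (fun _ hθ => (tan_pow_div_sin hθ).symm) measurableSet_Ioo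

theorem integral_tan_half_pow (m : ℕ) :
    ∫ θ in Ioo 0 (Real.pi / 2), Real.tan (θ / 2) ^ (m + 1) / Real.sin θ = 1 / ((m + 1 : ℕ) : ℝ) := by
  rw [setIntegral_congr_fun measurableSet_Ioo (fun _ hθ => tan_pow_div_sin hθ),
    setIntegral_Ioo_eq_sub (f := fun θ => Real.tan (θ / 2) ^ (m + 1) / ((m + 1 : ℕ) : ℝ))
      (fun θ hθ => ?_) (continuousOn_tan_half_pow m)]
  · rw [show Real.pi / 2 / 2 = Real.pi / 4 by ring, Real.tan_pi_div_four]
    simp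
  · have h1 := (Real.hasDerivAt_tan (cos_half_pos hθ).ne').comp θ ((hasDerivAt_id θ).div_const 2)
    have h2 := (h1.fun_pow (m + 1)).div_const ((m + 1 : ℕ) : ℝ)
    refine h2.congr_deriv ?_
    have : ((m + 1 : ℕ) : ℝ) ≠ 0 := by positivity
    simp only [Function.comp_apply, id, Nat.add_sub_cancel]
    field_simp

/-- The integral of `(1 - cos (n θ)) / sin θ` over the first quadrant. -/
def cosInt (n : ℕ) : ℝ := ∫ θ in Ioo 0 (Real.pi / 2), (1 - Real.cos (n * θ)) / Real.sin θ

/-- The integral of `θ ^ q / q! / sin θ` over the first quadrant. -/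
def powInt (q : ℕ) : ℝ := ∫ θ in Ioo 0 (Real.pi / 2), θ ^ q / (q.factorial : ℝ) / Real.sin θ

theorem abs_one_sub_cos_le {x : ℝ} (hx : 0 ≤ x) : |1 - Real.cos x| ≤ x := by
  rw [abs_of_nonneg (sub_nonneg.2 (Real.cos_le_one x))]
  rcases le_total x 2 with h | h
  · nlinarith [Real.one_sub_sq_div_two_le_cos (x := x)]
  · linarith [Real.neg_one_le_cos x]

theorem integrableOn_cosInt (n : ℕ) :
    IntegrableOn (fun θ => (1 - Real.cos (n * θ)) / Real.sin θ) (Ioo 0 (Real.pi / 2)) :=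
  (integrableOn_div_sin (f := fun θ => 1 - Real.cos (n * θ)) (by fun_prop) (C := n) fun _ hθ =>
    abs_one_sub_cos_le (mul_nonneg n.cast_nonneg hθ.1.le)).1

theorem abs_cosInt_le (n : ℕ) : |cosInt n| ≤ n * (Real.pi / 2) * (Real.pi / 2) :=
  (integrableOn_div_sin (f := fun θ => 1 - Real.cos (n * θ)) (by fun_prop) (C := n) fun _ hθ =>
    abs_one_sub_cos_le (mul_nonneg n.cast_nonneg hθ.1.le)).2

theorem integrableOn_powInt {q : ℕ} (hq : 1 ≤ q) :
    IntegrableOn (fun θ => θ ^ q / (q.factorial : ℝ) / Real.sin θ) (Ioo 0 (Real.pi / 2)) := by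
  refine (integrableOn_div_sin (f := fun θ => θ ^ q / (q.factorial : ℝ)) (by fun_prop)
    (C := (Real.pi / 2) ^ (q - 1)) fun θ hθ => ?_).1
  obtain ⟨q, rfl⟩ : ∃ k, q = k + 1 := ⟨q - 1, by omega⟩
  have h0 := hθ.1.le
  rw [abs_of_nonneg (by positivity), Nat.add_sub_cancel]
  have h1 : (1 : ℝ) ≤ ((q + 1).factorial : ℝ) := by
    exact_mod_cast Nat.one_le_iff_ne_zero.2 (Nat.factorial_ne_zero _)
  calc _ ≤ θ ^ (q + 1) := div_le_self (by positivity) h1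
    _ = θ ^ q * θ := pow_succ _ _
    _ ≤ _ := mul_le_mul_of_nonneg_right (pow_le_pow_left₀ h0 hθ.2.le q) h0

theorem summable_quad_mul_nat {l : ℕ} (hl : 1 ≤ l) :
    Summable fun n : ℕ => |quad n / (n : ℝ) ^ (2 * l + 1)| * n := by
  refine (summable_div_pow bounded_quad (by omega : 2 ≤ 2 * l)).abs.congr fun n => ?_
  rcases Nat.eq_zero_or_pos n with rfl | hn
  · simp [show l ≠ 0 by omega]
  · have : (0 : ℝ) < n := by exact_mod_cast hn
    rw [abs_div, abs_div, abs_of_pos (by positivity : (0 : ℝ) < (n : ℝ) ^ (2 * l)),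
      abs_of_pos (by positivity : (0 : ℝ) < (n : ℝ) ^ (2 * l + 1)), pow_succ]
    field_simp

theorem summable_quad_mul_cosInt {l : ℕ} (hl : 1 ≤ l) :
    Summable fun n : ℕ => quad n / (n : ℝ) ^ (2 * l + 1) * cosInt n := by
  refine Summable.of_norm_bounded ((summable_quad_mul_nat hl).mul_right
    ((Real.pi / 2) * (Real.pi / 2))) fun n => ?_
  rw [norm_mul, Real.norm_eq_abs, Real.norm_eq_abs, mul_assoc]
  refine mul_le_mul_of_nonneg_left ((abs_cosInt_le n).trans_eq (mul_assoc _ _ _)) (abs_nonneg _)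

theorem integral_fourier {l : ℕ} (hl : 1 ≤ l) :
    IntegrableOn (fun θ => (∑' n : ℕ, quad n / (n : ℝ) ^ (2 * l + 1) *
      (1 - Real.cos (n * θ))) / Real.sin θ) (Ioo 0 (Real.pi / 2)) ∧
    ∫ θ in Ioo 0 (Real.pi / 2), (∑' n : ℕ, quad n / (n : ℝ) ^ (2 * l + 1) *
      (1 - Real.cos (n * θ))) / Real.sin θ =
      ∑' n : ℕ, quad n / (n : ℝ) ^ (2 * l + 1) * cosInt n := by
  have hbd : ∀ (n : ℕ) (θ : ℝ), 0 ≤ θ → ‖quad n / (n : ℝ) ^ (2 * l + 1) *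
      (1 - Real.cos (n * θ))‖ ≤ |quad n / (n : ℝ) ^ (2 * l + 1)| * n * θ := fun n θ hθ => by
    rw [norm_mul, Real.norm_eq_abs, Real.norm_eq_abs, mul_assoc]
    exact mul_le_mul_of_nonneg_left (abs_one_sub_cos_le (mul_nonneg n.cast_nonneg hθ))
      (abs_nonneg _)
  constructor
  · refine (integrableOn_div_sin (C := ∑' n : ℕ, |quad n / (n : ℝ) ^ (2 * l + 1)| * n) ?_
      fun θ hθ => ?_).1
    · refine continuous_tsum (u := fun n : ℕ => |quad n / (n : ℝ) ^ (2 * l + 1)| * 2)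
        (fun n => by fun_prop)
        ((summable_div_pow bounded_quad (by omega : 2 ≤ 2 * l + 1)).abs.mul_right 2)
        fun n θ => ?_
      rw [norm_mul, Real.norm_eq_abs, Real.norm_eq_abs]
      refine mul_le_mul_of_nonneg_left ?_ (abs_nonneg _)
      rw [abs_le]
      constructor <;> linarith [Real.neg_one_le_cos (n * θ), Real.cos_le_one (n * θ)]
    · rw [← Real.norm_eq_abs, ← tsum_mul_right]
      exact tsum_of_norm_bounded ((summable_quad_mul_nat hl).mul_right θ).hasSum
        fun n => hbd n θ hθ.1.le
  · have h := hasSum_integral_of_summable_integral_norm (μ := volume.restrict (Ioo 0 (Real.pi / 2)))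
      (F := fun (n : ℕ) θ => quad n / (n : ℝ) ^ (2 * l + 1) * ((1 - Real.cos (n * θ)) / Real.sin θ))
      (fun n => (integrableOn_cosInt n).const_mul _) ?_
    · simp only [integral_const_mul] at h
      rw [show (∑' n : ℕ, quad n / (n : ℝ) ^ (2 * l + 1) * cosInt n) = _ from h.tsum_eq]
      refine integral_congr_ae (Eventually.of_forall fun θ => ?_)
      simp only
      rw [← tsum_div_const]
      exact tsum_congr fun n => mul_div_assoc _ _ _
    · refine (summable_quad_mul_cosInt hl).abs.congr fun n => ?_
      have hn : ∀ θ ∈ Ioo 0 (Real.pi / 2), 0 ≤ (1 - Real.cos (n * θ)) / Real.sin θ := fun θ hθ =>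
        div_nonneg (sub_nonneg.2 (Real.cos_le_one _)) (sin_pos_of_mem hθ).le
      simp only [norm_mul, integral_const_mul]
      rw [abs_mul, cosInt, abs_of_nonneg (setIntegral_nonneg measurableSet_Ioo hn),
        ← setIntegral_congr_fun measurableSet_Ioo fun θ hθ => Real.norm_of_nonneg (hn θ hθ)]
      rfl

/-- The coefficient sum defining the `S` value as a combination of integrals. -/
theorem tsum_bco_div {l : ℕ} (hl : 1 ≤ l) :
    ∑' m : ℕ, (Complex.I ^ m).re * bco (2 * l) m / m =
      ∑' n : ℕ, quad n / (n : ℝ) ^ (2 * l + 1) * cosInt n +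
        ∑ q ∈ Finset.Ico 1 (2 * l + 1),
          (Complex.I ^ q).re * powInt q * LSer quad (2 * l - q + 1) := by
  have hI : ∀ m, |(Complex.I ^ m).re| ≤ 1 := fun m =>
    (Complex.abs_re_le_norm _).trans (by simp)
  have hnn : ∀ (m : ℕ), ∀ θ ∈ Ioo 0 (Real.pi / 2), 0 ≤ Real.tan (θ / 2) ^ (m + 1) / Real.sin θ :=
    fun m θ hθ => div_nonneg (pow_nonneg (Real.tan_nonneg_of_nonneg_of_le_pi_div_two
      (by linarith [hθ.1]) (by linarith [hθ.1, hθ.2, Real.pi_pos])) _) (sin_pos_of_mem hθ).le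
  have h := hasSum_integral_of_summable_integral_norm (μ := volume.restrict (Ioo 0 (Real.pi / 2)))
    -- The index starts at m + 1 because 1/sin θ alone is not integrable; the coefficient at index 0
    -- is zero.
    (F := fun (m : ℕ) θ => (Complex.I ^ (m + 1)).re * bco (2 * l) (m + 1) *
      (Real.tan (θ / 2) ^ (m + 1) / Real.sin θ))
    (fun m => (integrableOn_tan_half_pow m).const_mul _) ?_
  · simp only [integral_const_mul, integral_tan_half_pow] at h
    have hs : Summable fun m : ℕ => (Complex.I ^ m).re * bco (2 * l) m / m :=
      (summable_nat_add_iff 1).1 (h.summable.congr fun m => by rw [mul_one_div])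
    have e1 : ∑' m : ℕ, (Complex.I ^ m).re * bco (2 * l) m / m =
        ∫ θ in Ioo 0 (Real.pi / 2), ∑' m : ℕ, (Complex.I ^ (m + 1)).re * bco (2 * l) (m + 1) *
          (Real.tan (θ / 2) ^ (m + 1) / Real.sin θ) := by
      rw [← h.tsum_eq, hs.tsum_eq_zero_add]
      simp only [mul_one_div, Nat.cast_zero, div_zero, zero_add]
    obtain ⟨h2, h3⟩ := integral_fourier hl
    have h4 : ∀ q ∈ Finset.Ico 1 (2 * l + 1), Integrable (fun θ : ℝ => (Complex.I ^ q).re *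
        LSer quad (2 * l - q + 1) * (θ ^ q / (q.factorial : ℝ) / Real.sin θ))
        (volume.restrict (Ioo 0 (Real.pi / 2))) := fun q hq =>
      (integrableOn_powInt (Finset.mem_Ico.1 hq).1).const_mul _
    rw [e1, ← h3]
    have e2 : ∑ q ∈ Finset.Ico 1 (2 * l + 1),
        (Complex.I ^ q).re * powInt q * LSer quad (2 * l - q + 1) =
        ∫ θ in Ioo 0 (Real.pi / 2), ∑ q ∈ Finset.Ico 1 (2 * l + 1), (Complex.I ^ q).re *
          LSer quad (2 * l - q + 1) * (θ ^ q / (q.factorial : ℝ) / Real.sin θ) := by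
      rw [integral_finsetSum _ h4]
      refine Finset.sum_congr rfl fun q _ => ?_
      rw [integral_const_mul, powInt]
      ring
    rw [e2, ← integral_add h2 (integrable_finsetSum _ h4)]
    refine setIntegral_congr_fun measurableSet_Ioo fun θ hθ => ?_
    have key := tsum_bco_mul_tan_pow hl hθ.1.le hθ.2
    have hz : ∑' m : ℕ, (Complex.I ^ (m + 1)).re * bco (2 * l) (m + 1) *
        (Real.tan (θ / 2) ^ (m + 1) / Real.sin θ) =
        (∑' m : ℕ, (Complex.I ^ m).re * bco (2 * l) m * Real.tan (θ / 2) ^ m) / Real.sin θ := by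
      rw [← tsum_div_const]
      have hinj : Function.Injective fun m : ℕ => m + 1 := add_left_injective 1
      rw [← hinj.tsum_eq (f := fun m : ℕ => (Complex.I ^ m).re * bco (2 * l) m *
        Real.tan (θ / 2) ^ m / Real.sin θ)]
      · exact tsum_congr fun m => by rw [mul_div_assoc]
      · intro m hm
        rcases m with _ | m
        · exact absurd (by simp [bco_zero_right]) hm
        · exact ⟨m, rfl⟩
    refine hz.trans ?_
    rw [key, add_div, Finset.sum_div]
    refine congrArg₂ (· + ·) rfl (Finset.sum_congr rfl fun q _ => by ring)
  · refine Summable.of_nonneg_of_le (fun m => integral_nonneg fun θ => norm_nonneg _) (fun m => ?_)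
      ((summable_nat_add_iff 1).2 (summable_bco_div (2 * l)))
    simp only [norm_mul, integral_const_mul]
    have hni : ∫ θ in Ioo 0 (Real.pi / 2), ‖Real.tan (θ / 2) ^ (m + 1) / Real.sin θ‖ =
        1 / ((m + 1 : ℕ) : ℝ) := by
      rw [← integral_tan_half_pow]
      exact setIntegral_congr_fun measurableSet_Ioo fun θ hθ => Real.norm_of_nonneg (hnn m θ hθ)
    rw [hni, mul_one_div, Real.norm_eq_abs, Real.norm_eq_abs]
    gcongr
    exact mul_le_of_le_one_left (abs_nonneg _) (hI _)

/-! ### Evaluation of the integrals -/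

/-- Riemann-Lebesgue lemma. If f is not integrable on the interval, all these integrals are 0 by
convention. -/
theorem tendsto_integral_mul_exp {f : ℝ → ℝ} :
    Tendsto (fun N : ℕ => ∫ θ in Ioo 0 (Real.pi / 2),
      (f θ : ℂ) * Complex.exp (2 * N * θ * Complex.I)) atTop (𝓝 0) := by
  have h := Real.tendsto_integral_exp_smul_cocompact
    ((Ioo 0 (Real.pi / 2)).indicator fun θ => (f θ : ℂ))
  -- The Fourier character is normalised with 2π, so the factor exp(2Niθ) belongs to the frequency
  -- -N/π.
  have hN : Tendsto (fun N : ℕ => -((N : ℝ) / Real.pi)) atTop (cocompact ℝ) := by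
    refine Tendsto.mono_right ?_ atBot_le_cocompact
    exact tendsto_neg_atTop_atBot.comp (tendsto_natCast_atTop_atTop.atTop_div_const Real.pi_pos)
  refine (h.comp hN).congr fun N => ?_
  rw [Function.comp_apply, ← integral_indicator measurableSet_Ioo]
  refine integral_congr_ae (Eventually.of_forall fun θ => ?_)
  by_cases hθ : θ ∈ Ioo 0 (Real.pi / 2)
  · simp only [indicator_of_mem hθ]
    rw [Circle.smul_def, Real.fourierChar_apply, smul_eq_mul, mul_comm]
    congr 2
    have := Complex.ofReal_ne_zero.2 Real.pi_ne_zero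
    push_cast
    field_simp
  · simp only [indicator_of_notMem hθ, smul_zero]

/-- The primitive of `θ ^ q / q! * exp (i b θ)`. -/
def expPrim (b : ℂ) (q : ℕ) (θ : ℝ) : ℂ :=
  -∑ k ∈ Finset.range (q + 1), (θ : ℂ) ^ k / (k.factorial : ℂ) * (Complex.I / b) ^ (q - k + 1) *
    Complex.exp (b * θ * Complex.I)

theorem expPrim_succ (b : ℂ) (q : ℕ) (θ : ℝ) : expPrim b (q + 1) θ =
    Complex.I / b * expPrim b q θ - (θ : ℂ) ^ (q + 1) / ((q + 1).factorial : ℂ) *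
      (Complex.I / b) * Complex.exp (b * θ * Complex.I) := by
  rw [expPrim, Finset.sum_range_succ, expPrim, mul_neg, Finset.mul_sum, neg_add, Nat.sub_self,
    zero_add, pow_one, sub_eq_add_neg]
  congr 2
  refine Finset.sum_congr rfl fun k hk => ?_
  rw [show q + 1 - k + 1 = (q - k + 1) + 1 by have := Finset.mem_range.1 hk; omega,
    pow_succ (Complex.I / b)]
  ring

theorem hasDerivAt_expPrim {b : ℂ} (hb : b ≠ 0) (q : ℕ) (θ : ℝ) :
    HasDerivAt (expPrim b q) ((θ : ℂ) ^ q / (q.factorial : ℂ) * Complex.exp (b * θ * Complex.I))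
      θ := by
  have hexp : HasDerivAt (fun θ : ℝ => Complex.exp (b * θ * Complex.I))
      (Complex.exp (b * θ * Complex.I) * (b * Complex.I)) θ := by
    have h := (((Complex.ofRealCLM.hasDerivAt (x := θ)).const_mul b).mul_const Complex.I).cexp
    simpa using h
  induction q with
  | zero =>
    have h := (hexp.const_mul (Complex.I / b)).neg
    have e : expPrim b 0 = fun θ : ℝ => -(Complex.I / b * Complex.exp (b * θ * Complex.I)) := by
      ext θ; simp [expPrim]
    rw [e]
    refine h.congr_deriv ?_
    field_simp
    simp
  | succ q ih =>
    have e : expPrim b (q + 1) = fun θ : ℝ => Complex.I / b * expPrim b q θ -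
        (θ : ℂ) ^ (q + 1) / ((q + 1).factorial : ℂ) * (Complex.I / b) *
          Complex.exp (b * θ * Complex.I) := funext (expPrim_succ b q)
    have hp : HasDerivAt (fun θ : ℝ => (θ : ℂ) ^ (q + 1)) (((q + 1 : ℕ) : ℂ) * (θ : ℂ) ^ q) θ := by
      have h := (Complex.ofRealCLM.hasDerivAt (x := θ)).fun_pow (q + 1)
      simpa using h
    have h := (ih.const_mul (Complex.I / b)).sub
      (((hp.div_const ((q + 1).factorial : ℂ)).mul_const (Complex.I / b)).mul hexp)
    rw [e]
    refine h.congr_deriv ?_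
    have hq : ((q + 1 : ℕ) : ℂ) ≠ 0 := Nat.cast_ne_zero.2 (Nat.succ_ne_zero q)
    have hf : (q.factorial : ℂ) ≠ 0 := Nat.cast_ne_zero.2 q.factorial_ne_zero
    rw [Nat.factorial_succ]
    push_cast at hq ⊢
    field_simp
    linear_combination (-b * (θ : ℂ) ^ (q + 1)) * Complex.I_sq

theorem integral_pow_mul_exp {b : ℂ} (hb : b ≠ 0) (q : ℕ) :
    ∫ θ in Ioo 0 (Real.pi / 2), (θ : ℂ) ^ q / (q.factorial : ℂ) *
      Complex.exp (b * θ * Complex.I) = expPrim b q (Real.pi / 2) - expPrim b q 0 :=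
  setIntegral_Ioo_eq_sub (fun θ _ => hasDerivAt_expPrim hb q θ) (by fun_prop)

theorem exp_odd_mul_pi_div_two (k : ℕ) :
    Complex.exp (((2 * k + 1 : ℕ) : ℂ) * ((Real.pi / 2 : ℝ) : ℂ) * Complex.I) =
      Complex.I * (-1) ^ k := by
  have e : ((2 * k + 1 : ℕ) : ℂ) * ((Real.pi / 2 : ℝ) : ℂ) * Complex.I =
      k * (Real.pi * Complex.I) + Real.pi / 2 * Complex.I := by
    push_cast; ring
  rw [e, Complex.exp_add, Complex.exp_nat_mul, Complex.exp_pi_mul_I, Complex.exp_pi_div_two_mul_I,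
    mul_comm]

/-- The real part of the normalised moment against `exp (i b θ)`, `b = 2 k + 1`. -/
theorem re_integral_pow_mul_exp (q k : ℕ) :
    (2 * (-Complex.I) ^ (q + 1) * ∫ θ in Ioo 0 (Real.pi / 2), (θ : ℂ) ^ q / (q.factorial : ℂ) *
      Complex.exp (((2 * k + 1 : ℕ) : ℂ) * θ * Complex.I)).re =
      2 / (2 * (k : ℝ) + 1) ^ (q + 1) - ∑ j ∈ Finset.range (q + 1),
        2 * (Complex.I ^ j).im * ((Real.pi / 2) ^ j / (j.factorial : ℝ)) *
          ((-1) ^ k / (2 * (k : ℝ) + 1) ^ (q - j + 1)) := by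
  have hb : ((2 * k + 1 : ℕ) : ℂ) ≠ 0 := Nat.cast_ne_zero.2 (Nat.succ_ne_zero _)
  rw [integral_pow_mul_exp hb]
  set b : ℂ := ((2 * k + 1 : ℕ) : ℂ) with hbdef
  have hbr : b = ((2 * (k : ℝ) + 1 : ℝ) : ℂ) := by rw [hbdef]; push_cast; rfl
  have hI : ∀ n : ℕ, (-Complex.I) ^ n * Complex.I ^ n = 1 := fun n => by
    rw [← mul_pow, neg_mul, Complex.I_mul_I, neg_neg, one_pow]
  have h0 : expPrim b q 0 = -(Complex.I / b) ^ (q + 1) := by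
    rw [expPrim, Finset.sum_range_succ']
    simp
  have h1 : 2 * (-Complex.I) ^ (q + 1) * (expPrim b q (Real.pi / 2) - expPrim b q 0) =
      2 / b ^ (q + 1) - ∑ j ∈ Finset.range (q + 1), ((2 * ((Real.pi / 2) ^ j / (j.factorial : ℝ)) *
          ((-1) ^ k / (2 * (k : ℝ) + 1) ^ (q - j + 1)) : ℝ) : ℂ) *
          (Complex.I * (-Complex.I) ^ j) := by
    rw [h0, expPrim, hbdef, exp_odd_mul_pi_div_two, ← hbdef, mul_sub, mul_neg, mul_neg, sub_neg_eq_add,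
      div_pow, Finset.mul_sum, add_comm, ← sub_eq_add_neg]
    congr 1
    · linear_combination (2 / b ^ (q + 1)) * hI (q + 1)
    · refine Finset.sum_congr rfl fun j hj => ?_
      have hj' : q + 1 = j + (q - j + 1) := by have := Finset.mem_range.1 hj; omega
      have e : (-Complex.I) ^ (q + 1) = (-Complex.I) ^ j * (-Complex.I) ^ (q - j + 1) := by
        rw [← pow_add, ← hj']
      rw [e, div_pow, hbr]
      push_cast
      linear_combination (2 * (-Complex.I) ^ j * ((Real.pi / 2 : ℂ) ^ j / (j.factorial : ℂ)) *
        Complex.I * ((-1) ^ k / (2 * (k : ℂ) + 1) ^ (q - j + 1))) * hI (q - j + 1)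
  rw [h1, Complex.sub_re, Complex.re_sum, hbr]
  congr 1
  · rw [← Complex.ofReal_pow, ← Complex.ofReal_ofNat, ← Complex.ofReal_div, Complex.ofReal_re]
  · refine Finset.sum_congr rfl fun j _ => ?_
    have e : (Complex.I * (-Complex.I) ^ j).re = (Complex.I ^ j).im := by
      rw [Complex.I_mul_re, show (-Complex.I) = (starRingEnd ℂ) Complex.I by simp, ← map_pow,
        Complex.conj_im, neg_neg]
    rw [Complex.re_ofReal_mul, e]
    ring

theorem tendsto_sum_two_div_odd_pow {s : ℕ} (hs : 2 ≤ s) :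
    Tendsto (fun N => ∑ k ∈ Finset.range N, 2 / (2 * (k : ℝ) + 1) ^ s) atTop
      (𝓝 (LSer oddInd s)) := by
  have h := (tendsto_LSer_of_bounded bounded_oddInd hs).comp
    (tendsto_atTop_atTop.2 fun b => ⟨b, fun a ha => by omega⟩ :
      Tendsto (fun N : ℕ => 2 * N) atTop atTop)
  refine h.congr fun N => ?_
  rw [Function.comp_apply, sum_Ico_one_eq_sum_range (by simp [show s ≠ 0 by omega])]
  have e := sum_range_odd (fun k => 2 / (2 * (k : ℝ) + 1) ^ s) (2 * N)
  rw [Nat.mul_div_cancel_left N two_pos] at e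
  rw [← e]
  refine Finset.sum_congr rfl fun m _ => ?_
  rw [oddInd]
  split_ifs with h
  · rw [h.neg_one_pow]; simp
  · rw [(Nat.not_even_iff_odd.1 h).neg_one_pow]
    obtain ⟨k, rfl⟩ := Nat.not_even_iff_odd.1 h
    rw [show (2 * k + 1) / 2 = k by omega]
    push_cast
    norm_num

/-- The combination of beta values and powers of `π` occurring in the moments of `1 / sin`. -/
def betaPoly (q : ℕ) : ℝ := ∑ j ∈ Finset.range (q + 1),
  2 * (Complex.I ^ j).im * ((Real.pi / 2) ^ j / (j.factorial : ℝ)) * LSer chi (q - j + 1)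

/-- Since 2i sin θ = exp(iθ) - exp(-iθ), each product is a difference of consecutive even
exponentials and the sum telescopes. -/
theorem sum_exp_odd_mul (N : ℕ) (θ : ℝ) :
    (∑ k ∈ Finset.range N, Complex.exp (((2 * k + 1 : ℕ) : ℂ) * θ * Complex.I)) *
      (2 * Complex.I * Complex.sin θ) = Complex.exp (2 * N * θ * Complex.I) - 1 := by
  have hs : 2 * Complex.I * Complex.sin θ =
      Complex.exp (θ * Complex.I) - Complex.exp (-θ * Complex.I) := by
    rw [Complex.sin]
    linear_combination (Complex.exp (-θ * Complex.I) - Complex.exp (θ * Complex.I)) * Complex.I_sq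
  induction N with
  | zero => simp
  | succ N ih =>
    rw [Finset.sum_range_succ, add_mul, ih, hs, mul_sub, ← Complex.exp_add, ← Complex.exp_add]
    have e1 : ((2 * N + 1 : ℕ) : ℂ) * θ * Complex.I + θ * Complex.I =
      2 * ((N + 1 : ℕ) : ℂ) * θ * Complex.I := by push_cast; ring
    have e2 : ((2 * N + 1 : ℕ) : ℂ) * θ * Complex.I + -θ * Complex.I =
      2 * N * θ * Complex.I := by push_cast; ring
    rw [e1, e2]
    ring

/-- Integrate θ^q/q! against the sum of exp(i(2k+1)θ) over k < N, which is (exp(2iNθ) - 1)/(2i sin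
θ). The oscillating part tends to 0 and leaves the moment of 1/sin; termwise, the endpoint 0 yields
the sum over odd integers and the endpoint π/2 the beta values. For odd q the left side is 0 and the
identity is a relation between these two. -/
theorem I_pow_re_mul_powInt {q : ℕ} (hq : 1 ≤ q) :
    (Complex.I ^ q).re * powInt q = LSer oddInd (q + 1) - betaPoly q := by
  have hA : Tendsto (fun N => ∑ k ∈ Finset.range N, (2 / (2 * (k : ℝ) + 1) ^ (q + 1) -
      ∑ j ∈ Finset.range (q + 1),
        2 * (Complex.I ^ j).im * ((Real.pi / 2) ^ j / (j.factorial : ℝ)) *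
          ((-1) ^ k / (2 * (k : ℝ) + 1) ^ (q - j + 1)))) atTop
      (𝓝 (LSer oddInd (q + 1) - betaPoly q)) := by
    have h2 := tendsto_finsetSum (Finset.range (q + 1)) fun j _ =>
      (tendsto_betaTrunc (Nat.le_add_left 1 (q - j))).const_mul
        (2 * (Complex.I ^ j).im * ((Real.pi / 2) ^ j / (j.factorial : ℝ)))
    refine ((tendsto_sum_two_div_odd_pow (by omega)).sub h2).congr fun N => ?_
    rw [Finset.sum_sub_distrib, Finset.sum_comm]
    simp only [betaTrunc, Finset.mul_sum]
  have hint : Integrable (fun θ => ((θ ^ q / (q.factorial : ℝ) / Real.sin θ : ℝ) : ℂ))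
      (volume.restrict (Ioo 0 (Real.pi / 2))) := (integrableOn_powInt hq).ofReal
  -- The factor (-i)^(q+1) makes the contribution of the endpoint 0 real and positive, since that
  -- contribution carries (i/(2k+1))^(q+1).
  have hB : Tendsto (fun N : ℕ => (∑ k ∈ Finset.range N, 2 * (-Complex.I) ^ (q + 1) *
      ∫ θ in Ioo 0 (Real.pi / 2), (θ : ℂ) ^ q / (q.factorial : ℂ) *
        Complex.exp (((2 * k + 1 : ℕ) : ℂ) * θ * Complex.I)).re) atTop
      (𝓝 ((Complex.I ^ q).re * powInt q)) := by
    have h1 := (((tendsto_integral_mul_exp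
      (f := fun θ => θ ^ q / (q.factorial : ℝ) / Real.sin θ)).sub_const (powInt q : ℂ)).const_mul
      (-Complex.I * (-Complex.I) ^ (q + 1)))
    have h2 := (Complex.continuous_re.tendsto _).comp h1
    have e0 : (-Complex.I * (-Complex.I) ^ (q + 1) * (0 - (powInt q : ℂ))).re =
        (Complex.I ^ q).re * powInt q := by
      have : -Complex.I * (-Complex.I) ^ (q + 1) * (0 - (powInt q : ℂ)) =
          (-Complex.I) ^ q * (powInt q : ℂ) := by
        linear_combination (-(-Complex.I) ^ q * (powInt q : ℂ)) * Complex.I_sq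
      rw [this, Complex.re_mul_ofReal, show (-Complex.I) = (starRingEnd ℂ) Complex.I by simp,
        ← map_pow, Complex.conj_re]
    rw [e0] at h2
    refine h2.congr fun N => ?_
    rw [Function.comp_apply]
    congr 1
    have hexp : Integrable (fun θ : ℝ => ((θ ^ q / (q.factorial : ℝ) / Real.sin θ : ℝ) : ℂ) *
        Complex.exp (2 * N * θ * Complex.I)) (volume.restrict (Ioo 0 (Real.pi / 2))) := by
      refine hint.mul_bdd (c := 1) (by fun_prop) (Eventually.of_forall fun θ => ?_)
      rw [show (2 * N * θ * Complex.I : ℂ) = ((2 * N * θ : ℝ) : ℂ) * Complex.I by push_cast; rfl,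
        Complex.norm_exp_ofReal_mul_I]
    have hk : ∀ k ∈ Finset.range N, Integrable (fun θ : ℝ => (θ : ℂ) ^ q / (q.factorial : ℂ) *
        Complex.exp (((2 * k + 1 : ℕ) : ℂ) * θ * Complex.I))
        (volume.restrict (Ioo 0 (Real.pi / 2))) := fun k _ =>
      (Continuous.integrableOn_Icc (by fun_prop)).mono_set Ioo_subset_Icc_self
    have hp : (powInt q : ℂ) = ∫ θ in Ioo 0 (Real.pi / 2),
        ((θ ^ q / (q.factorial : ℝ) / Real.sin θ : ℝ) : ℂ) := integral_complex_ofReal.symm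
    rw [← Finset.mul_sum, ← integral_finsetSum _ hk, hp,
      ← integral_sub hexp hint, ← integral_const_mul, ← integral_const_mul]
    refine setIntegral_congr_fun measurableSet_Ioo fun θ hθ => ?_
    rw [← Finset.mul_sum]
    have hsin : Complex.sin θ ≠ 0 := by
      rw [← Complex.ofReal_sin]; exact_mod_cast (sin_pos_of_mem hθ).ne'
    have hsum := sum_exp_odd_mul N θ
    push_cast at hsum ⊢
    generalize Complex.exp (2 * N * θ * Complex.I) = A at hsum ⊢
    generalize ∑ k ∈ Finset.range N, Complex.exp ((2 * (k : ℂ) + 1) * θ * Complex.I) = B at hsum ⊢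
    generalize (-Complex.I) ^ (q + 1) = P
    generalize (θ : ℂ) ^ q / (q.factorial : ℂ) = T
    have e : T / Complex.sin θ * A - T / Complex.sin θ = 2 * Complex.I * (T * B) := by
      rw [← mul_sub_one, ← hsum]
      field_simp
    rw [e]
    linear_combination (-2 * P * T * B) * Complex.I_sq
  refine tendsto_nhds_unique hB (hA.congr fun N => ?_)
  rw [Complex.re_sum]
  exact Finset.sum_congr rfl fun k _ => (re_integral_pow_mul_exp q k).symm

/-! ### Recurrences in the shift -/

theorem chi_add_two (n : ℕ) : chi (n + 2) = -chi n := by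
  rw [chi, chi, show (n + 2) / 2 = n / 2 + 1 by omega, pow_succ]
  simp only [Nat.even_add, even_two, iff_true]
  split_ifs <;> simp

theorem oddInd_add_two (n : ℕ) : oddInd (n + 2) = oddInd n := by
  rw [oddInd, oddInd, pow_add]; norm_num

theorem abs_chi_le (n : ℕ) : |chi n| ≤ 1 := by
  rw [chi]; split_ifs
  · simp
  · rw [abs_neg_one_pow]

theorem tendsto_bounded_div_add {f : ℕ → ℝ} (hf : ∃ B, ∀ n, 1 ≤ n → |f n| ≤ B) (n : ℕ) :
    Tendsto (fun N : ℕ => f N / ((n : ℝ) + N)) atTop (𝓝 0) := by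
  obtain ⟨B, hB⟩ := hf
  refine squeeze_zero_norm' ?_ (tendsto_const_div_atTop_nhds_zero_nat B)
  filter_upwards [eventually_ge_atTop 1] with N hN
  have hN' : (0 : ℝ) < N := by exact_mod_cast hN
  rw [Real.norm_eq_abs, abs_div, abs_of_pos (by positivity : (0 : ℝ) < (n : ℝ) + N)]
  exact div_le_div₀ ((abs_nonneg _).trans (hB N hN)) (hB N hN) hN'
    (by linarith [(n.cast_nonneg : (0 : ℝ) ≤ n)])

theorem tendsto_bounded_div_add_succ {f : ℕ → ℝ} (hf : ∃ B, ∀ n, 1 ≤ n → |f n| ≤ B) (n : ℕ) :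
    Tendsto (fun N : ℕ => f (N + 1) / ((n : ℝ) + N + 1)) atTop (𝓝 0) := by
  refine ((tendsto_bounded_div_add hf n).comp (tendsto_add_atTop_nat 1)).congr fun N => ?_
  simp only [Function.comp_apply]
  push_cast
  rw [add_assoc]

/-- Because χ(m + 2) = -χ(m), the sum of the two shifted series telescopes; χ(1) = 1 and χ(2) = 0
leave only 1/(n + 1). -/
theorem hat_chi_add_two (n : ℕ) : hat chi (n + 2) = 1 / ((n : ℝ) + 1) - hat chi n := by
  have hb : ∃ B, ∀ n, 1 ≤ n → |chi n| ≤ B := ⟨1, fun n _ => abs_chi_le n⟩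
  have h1 := (bddPartial_chi.tendsto_hat (n + 2)).add (bddPartial_chi.tendsto_hat n)
  have h2 := ((tendsto_bounded_div_add hb n).add (tendsto_bounded_div_add_succ hb n)).const_sub
    (1 / ((n : ℝ) + 1))
  rw [add_zero, sub_zero] at h2
  refine eq_sub_of_add_eq (tendsto_nhds_unique h1 (h2.congr' ?_))
  filter_upwards [eventually_ge_atTop 1] with N hN
  induction N, hN using Nat.le_induction with
  | base => simp [chi]
  | succ N hN ih =>
    rw [Finset.sum_Ico_succ_top hN, Finset.sum_Ico_succ_top hN, chi_add_two]
    push_cast at ih ⊢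
    linear_combination ih

theorem tendsto_oddInd_step (n : ℕ) :
    Tendsto (fun N => ∑ m ∈ Finset.Ico 1 N,
      oddInd m * (1 / ((n : ℝ) + m) - 1 / ((n : ℝ) + 2 + m))) atTop (𝓝 (2 / ((n : ℝ) + 1))) := by
  have h2 := ((tendsto_bounded_div_add bounded_oddInd n).add
    (tendsto_bounded_div_add_succ bounded_oddInd n)).const_sub (2 / ((n : ℝ) + 1))
  rw [add_zero, sub_zero] at h2
  refine h2.congr' ?_
  filter_upwards [eventually_ge_atTop 1] with N hN
  induction N, hN using Nat.le_induction with
  | base => norm_num [oddInd]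
  | succ N hN ih =>
    rw [Finset.sum_Ico_succ_top hN, oddInd_add_two]
    push_cast at ih ⊢
    linear_combination ih

theorem tendsto_one_div_sub (n : ℕ) :
    Tendsto (fun N : ℕ => ∑ m ∈ Finset.Ico 1 N, (1 / (m : ℝ) - 1 / ((n : ℝ) + m))) atTop
      (𝓝 (harm (n + 1))) := by
  induction n with
  | zero => simp [harm]
  | succ n ih =>
    have h := ih.add ((tendsto_bounded_div_add bounded_one n).const_sub (1 / ((n : ℝ) + 1)))
    rw [sub_zero] at h
    rw [harm, Finset.sum_Ico_succ_top (by omega), ← harm]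
    push_cast
    refine h.congr' ?_
    filter_upwards [eventually_ge_atTop 1] with N hN
    induction N, hN using Nat.le_induction with
    | base => simp
    | succ N hN ih =>
      rw [Finset.sum_Ico_succ_top hN, Finset.sum_Ico_succ_top hN]
      push_cast at ih ⊢
      rw [show (n : ℝ) + 1 + N = n + (N + 1) by ring]
      linear_combination ih

theorem mul_hat₂_eq {g : ℕ → ℝ} (hg : ∃ B, ∀ n, 1 ≤ n → |g n| ≤ B) {n : ℕ} {x : ℝ}
    (h : Tendsto (fun N => ∑ m ∈ Finset.Ico 1 N, g m * (1 / (m : ℝ) - 1 / ((n : ℝ) + m))) atTop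
      (𝓝 x)) : (n : ℝ) * hat₂ g n = x := by
  refine tendsto_nhds_unique ((tendsto_hat₂ hg n).const_mul (n : ℝ)) (h.congr fun N => ?_)
  rw [Finset.mul_sum]
  refine Finset.sum_congr rfl fun m hm => ?_
  have : (0 : ℝ) < m := by exact_mod_cast (Finset.mem_Ico.1 hm).1
  have h2 : (0 : ℝ) < n + m := by positivity
  field_simp
  ring

theorem mul_hat₂_one (n : ℕ) : (n : ℝ) * hat₂ (fun _ => 1) n = harm (n + 1) :=
  mul_hat₂_eq bounded_one ((tendsto_one_div_sub n).congr fun N => by simp)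

/-! ### The cosine integrals as shifted sums over odd integers -/

theorem cosInt_zero : cosInt 0 = 0 := by simp [cosInt]

theorem cosInt_one : cosInt 1 = Real.log 2 := by
  have hpos : ∀ θ ∈ Icc 0 (Real.pi / 2), 0 < 1 + Real.cos θ := fun θ hθ => by
    have : 0 ≤ Real.cos θ := Real.cos_nonneg_of_mem_Icc ⟨by linarith [hθ.1, Real.pi_pos], hθ.2⟩
    linarith
  have e : EqOn (fun θ => (1 - Real.cos ((1 : ℕ) * θ)) / Real.sin θ)
      (fun θ => -(-Real.sin θ / (1 + Real.cos θ))) (Ioo 0 (Real.pi / 2)) := fun θ hθ => by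
    have h1 := (sin_pos_of_mem hθ).ne'
    have h2 := (hpos θ (Ioo_subset_Icc_self hθ)).ne'
    simp only [Nat.cast_one, one_mul]
    field_simp
    linear_combination -Real.sin_sq_add_cos_sq θ
  rw [cosInt, setIntegral_congr_fun measurableSet_Ioo e, setIntegral_Ioo_eq_sub
    (f := fun θ => -Real.log (1 + Real.cos θ))
    (fun θ hθ => (((Real.hasDerivAt_cos θ).const_add 1).log (hpos θ hθ).ne').neg)]
  · norm_num
  · exact (ContinuousOn.div (by fun_prop) (by fun_prop) fun θ hθ => (hpos θ hθ).ne').neg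

theorem cos_succ_mul_pi_div_two (n : ℕ) :
    Real.cos (((n : ℝ) + 1) * (Real.pi / 2)) = -chi n := by
  rcases Nat.even_or_odd' n with ⟨k, rfl | rfl⟩
  · rw [chi, if_pos (even_two_mul k), show (((2 * k : ℕ) : ℝ) + 1) * (Real.pi / 2) =
      Real.pi / 2 + k * Real.pi by push_cast; ring, Real.cos_add_nat_mul_pi]
    simp
  · rw [chi, if_neg (by simp), show (((2 * k + 1 : ℕ) : ℝ) + 1) * (Real.pi / 2) =
      ((k + 1 : ℕ) : ℝ) * Real.pi by push_cast; ring, Real.cos_nat_mul_pi,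
      show (2 * k + 1) / 2 = k by omega, pow_succ]
    ring

/-- The identity cos(nθ) - cos((n+2)θ) = 2 sin((n+1)θ) sin θ cancels the denominator; χ(n) enters
through the endpoint value cos((n+1)π/2). -/
theorem cosInt_add_two (n : ℕ) : cosInt (n + 2) = cosInt n + 2 * (1 + chi n) / ((n : ℝ) + 1) := by
  have hn : (n : ℝ) + 1 ≠ 0 := by positivity
  have h : cosInt (n + 2) - cosInt n =
      ∫ θ in Ioo 0 (Real.pi / 2), 2 * Real.sin (((n : ℝ) + 1) * θ) := by
    rw [cosInt, cosInt, ← integral_sub (integrableOn_cosInt _) (integrableOn_cosInt _)]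
    refine setIntegral_congr_fun measurableSet_Ioo fun θ hθ => ?_
    have hs := (sin_pos_of_mem hθ).ne'
    have e1 : (((n + 2 : ℕ) : ℝ)) * θ = ((n : ℝ) + 1) * θ + θ := by push_cast; ring
    have e2 : (n : ℝ) * θ = ((n : ℝ) + 1) * θ - θ := by ring
    rw [e1, e2, Real.cos_add, Real.cos_sub]
    field_simp
    ring
  rw [setIntegral_Ioo_eq_sub (f := fun θ => -(2 / ((n : ℝ) + 1)) * Real.cos (((n : ℝ) + 1) * θ))
    (fun θ _ => ?_) (by fun_prop), cos_succ_mul_pi_div_two, mul_zero, Real.cos_zero] at h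
  · rw [eq_add_of_sub_eq h]
    ring
  · have h1 := ((((hasDerivAt_id θ).const_mul ((n : ℝ) + 1)).cos)).const_mul (-(2 / ((n : ℝ) + 1)))
    refine h1.congr_deriv ?_
    simp only [id]
    field_simp

theorem chi_eq_neg_altEven (a : ℕ) : chi a = -altEven (a + 1) := by
  rw [chi, altEven]
  by_cases h : Even a
  · rw [if_pos h, if_neg (by rwa [Nat.even_add_one, not_not]), neg_zero]
  · rw [if_neg h, if_pos (by rwa [Nat.even_add_one])]
    obtain ⟨k, rfl⟩ := Nat.not_even_iff_odd.1 h
    rw [show (2 * k + 1) / 2 = k by omega, show (2 * k + 1 + 1) / 2 = k + 1 by omega, pow_succ]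
    ring

theorem hat_chi_one : hat chi 1 = Real.log 2 / 2 := by
  have h := ((bddPartial_altEven.tendsto_LSer le_rfl).comp (tendsto_add_atTop_nat 1)).neg
  rw [LSer_altEven le_rfl, LSer_alt_one] at h
  have e : Real.log 2 / 2 = -(-Real.log 2 / 2 ^ 1) := by ring
  rw [e]
  refine tendsto_nhds_unique (bddPartial_chi.tendsto_hat 1) (h.congr' ?_)
  filter_upwards [eventually_ge_atTop 1] with N hN
  induction N, hN using Nat.le_induction with
  | base => simp [altEven]
  | succ N hN ih =>
    simp only [Function.comp_apply] at ih ⊢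
    rw [Finset.sum_Ico_succ_top hN, ← ih, Finset.sum_Ico_succ_top (by omega), chi_eq_neg_altEven]
    push_cast
    ring

theorem tendsto_oddInd_one : Tendsto (fun N => ∑ m ∈ Finset.Ico 1 N,
    oddInd m * (1 / (m : ℝ) - 1 / (((1 : ℕ) : ℝ) + m))) atTop (𝓝 (2 * Real.log 2)) := by
  have h1 := (tendsto_hat₂ bounded_oddInd 1).const_mul ((1 : ℕ) : ℝ)
  have h2 : Tendsto (fun N => ∑ m ∈ Finset.Ico 1 N,
      oddInd m * (1 / (m : ℝ) - 1 / (((1 : ℕ) : ℝ) + m))) atTop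
      (𝓝 (((1 : ℕ) : ℝ) * hat₂ oddInd 1)) := by
    refine h1.congr fun N => ?_
    rw [Finset.mul_sum]
    refine Finset.sum_congr rfl fun m hm => ?_
    have : (0 : ℝ) < m := by exact_mod_cast (Finset.mem_Ico.1 hm).1
    have h2 : (0 : ℝ) < ((1 : ℕ) : ℝ) + m := by positivity
    field_simp
    ring
  -- Convergence is already known, so the limit may be read off along odd cutoffs, where every odd m
  -- is paired with m + 1 and the partial sum is -2 times that of the alternating harmonic series.
  have hodd : Tendsto (fun M : ℕ => 2 * M + 1) atTop atTop :=
    tendsto_atTop_atTop.2 fun b => ⟨b, fun a ha => by omega⟩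
  have h3 := ((bddPartial_alt.tendsto_LSer le_rfl).comp hodd).const_mul (-2)
  rw [LSer_alt_one] at h3
  have e : 2 * Real.log 2 = ((1 : ℕ) : ℝ) * hat₂ oddInd 1 := by
    rw [show 2 * Real.log 2 = -2 * -Real.log 2 by ring]
    refine tendsto_nhds_unique h3 ((h2.comp hodd).congr fun M => ?_)
    simp only [Function.comp_apply]
    induction M with
    | zero => simp
    | succ M ih =>
      simp only [show 2 * (M + 1) + 1 = 2 * M + 1 + 1 + 1 by ring,
        Finset.sum_Ico_succ_top (show 1 ≤ 2 * M + 1 + 1 by omega),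
        Finset.sum_Ico_succ_top (show 1 ≤ 2 * M + 1 by omega), ih]
      simp only [oddInd, alt, pow_succ, pow_mul]
      push_cast
      norm_num
      ring
  rw [e]
  exact h2

/-- Both sides grow by 2/(n + 1) when n increases by 2: the χ(n) part of the recurrence for `cosInt`
cancels against the inhomogeneous term of the one for `hat chi`. The cases n = 0 and n = 1 start the
induction. -/
theorem tendsto_oddInd_sub (n : ℕ) :
    Tendsto (fun N => ∑ m ∈ Finset.Ico 1 N, oddInd m * (1 / (m : ℝ) - 1 / ((n : ℝ) + m))) atTop
      (𝓝 (cosInt n + 2 * chi n * hat chi n)) := by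
  induction n using Nat.twoStepInduction with
  | zero => simp [cosInt_zero, chi]
  | one =>
    have : chi 1 = 1 := by simp [chi]
    rw [cosInt_one, hat_chi_one, this, show Real.log 2 + 2 * 1 * (Real.log 2 / 2) =
      2 * Real.log 2 by ring]
    exact tendsto_oddInd_one
  | more n ih _ =>
    have h := ih.add (tendsto_oddInd_step n)
    have e : cosInt (n + 2) + 2 * chi (n + 2) * hat chi (n + 2) =
        cosInt n + 2 * chi n * hat chi n + 2 / ((n : ℝ) + 1) := by
      rw [cosInt_add_two, chi_add_two, hat_chi_add_two]
      ring
    rw [e]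
    refine h.congr fun N => ?_
    rw [← Finset.sum_add_distrib]
    refine Finset.sum_congr rfl fun m _ => ?_
    push_cast
    ring

theorem mul_hat₂_oddInd (n : ℕ) :
    (n : ℝ) * hat₂ oddInd n = cosInt n + 2 * chi n * hat chi n :=
  mul_hat₂_eq bounded_oddInd (tendsto_oddInd_sub n)

end

/-! ### Assembly -/

theorem trunc_parityS_replicate (j N : ℕ) :
    trunc (parityS (List.replicate j (pl 1) ++ [bar 1])) N = ∑ m ∈ Finset.Ico 1 N, bco j m := by
  induction j generalizing N with
  | zero => simp [parityS, bar, trunc, bco]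
  | succ j ih =>
    rw [List.replicate_succ, List.cons_append, pl, parityS, trunc, ← pl]
    refine Finset.sum_congr rfl fun m _ => ?_
    rw [ih, bco]
    simp

theorem I_pow_re (m : ℕ) : (Complex.I ^ m).re = altEven m := by
  rcases Nat.even_or_odd' m with ⟨k, rfl | rfl⟩
  · rw [altEven, if_pos (even_two_mul k), pow_mul, Complex.I_sq, Nat.mul_div_cancel_left k two_pos,
      ← Complex.ofReal_one, ← Complex.ofReal_neg, ← Complex.ofReal_pow, Complex.ofReal_re]
  · rw [altEven, if_neg (by simp), pow_succ, pow_mul, Complex.I_sq, ← Complex.ofReal_one,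
      ← Complex.ofReal_neg, ← Complex.ofReal_pow, Complex.re_ofReal_mul, Complex.I_re, mul_zero]

theorem I_pow_im (m : ℕ) : (Complex.I ^ m).im = chi m := by
  rcases Nat.even_or_odd' m with ⟨k, rfl | rfl⟩
  · rw [chi, if_pos (even_two_mul k), pow_mul, Complex.I_sq,
      ← Complex.ofReal_one, ← Complex.ofReal_neg, ← Complex.ofReal_pow, Complex.ofReal_im]
  · rw [chi, if_neg (by simp), pow_succ, pow_mul, Complex.I_sq, ← Complex.ofReal_one,
      ← Complex.ofReal_neg, ← Complex.ofReal_pow, Complex.im_ofReal_mul, Complex.I_im, mul_one,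
      show (2 * k + 1) / 2 = k by omega]

/-- The outer index is even with weight 2 (-1)^(m/2) / m². One factor 2/m is absorbed as one more
step of the recursion for `bco`, which leaves the sign and 1/m. -/
theorem trunc_args {l : ℕ} (hl : 1 ≤ l) (N : ℕ) : trunc (parityS (args l)) N =
    ∑ m ∈ Finset.Ico 1 N, (Complex.I ^ m).re * bco (2 * l) m / m := by
  rw [args, show bar 2 = (-1, 2) from rfl, parityS, trunc]
  refine Finset.sum_congr rfl fun m hm => ?_
  obtain ⟨j, hj⟩ : ∃ j, 2 * l = j + 1 := ⟨2 * l - 1, by omega⟩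
  have hlen : (List.replicate (2 * l - 1) (pl 1) ++ [bar 1]).length = 2 * l := by simp; omega
  rw [trunc_parityS_replicate, hlen, pow_mul, neg_one_sq, one_pow, term_one_neg, I_pow_re,
    show 2 * l - 1 = j by omega, hj, bco, term_parity, ← hj]
  have hm0 : (0 : ℝ) < m := by exact_mod_cast (Finset.mem_Ico.1 hm).1
  by_cases h : Even m
  · rw [if_pos (h.add (even_two_mul l))]
    field_simp
  · rw [altEven, if_neg h]
    simp

theorem tendsto_trunc_args {l : ℕ} (hl : 1 ≤ l) :
    Tendsto (trunc (parityS (args l))) atTop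
      (𝓝 (∑' m : ℕ, (Complex.I ^ m).re * bco (2 * l) m / m)) := by
  have hs : Summable fun m : ℕ => (Complex.I ^ m).re * bco (2 * l) m / m := by
    refine Summable.of_norm_bounded (summable_bco_div (2 * l)) fun m => ?_
    rw [norm_div, norm_mul, Real.norm_eq_abs, Real.norm_eq_abs, Real.norm_natCast]
    gcongr
    exact mul_le_of_le_one_left (abs_nonneg _) ((Complex.abs_re_le_norm _).trans (by simp))
  exact (tendsto_sum_Ico_tsum hs (by simp)).congr fun N => (trunc_args hl N).symm

theorem betaPoly_eq (q : ℕ) : betaPoly q = ∑ k ∈ Finset.range ((q + 1) / 2),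
    2 * (-1) ^ k * ((Real.pi / 2) ^ (2 * k + 1) / ((2 * k + 1).factorial : ℝ)) *
      LSer chi (q - 2 * k) := by
  rw [betaPoly, ← sum_range_odd]
  refine Finset.sum_congr rfl fun j hj => ?_
  rw [I_pow_im, chi]
  split_ifs with h
  · simp
  · obtain ⟨k, rfl⟩ := Nat.not_even_iff_odd.1 h
    have := Finset.mem_range.1 hj
    rw [show (2 * k + 1) / 2 = k by omega, show q - (2 * k + 1) + 1 = q - 2 * k by omega]

/-- Expand `betaPoly` into its odd powers of π/2 and exchange the summations over k and p. -/
theorem sum_beta_zeta_pi {l : ℕ} (hl : 1 ≤ l) :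
    (∑ k ∈ Finset.range l, ∑ x ∈ Finset.HasAntidiagonal.antidiagonal (2 * l - 1 - 2 * k),
        2 * (-1 : ℝ) ^ (1 + k + x.1) * beta (x.2 + 1) * (2 - 1 / 2 ^ x.1) *
          zeta [bar (x.1 + 1)] *
          (1 / ((2 * k + 1).factorial : ℝ) * (Real.pi / 2) ^ (2 * k + 1))) =
      -∑ x ∈ Finset.HasAntidiagonal.antidiagonal (2 * l - 1),
        (-1 : ℝ) ^ x.1 * (LSer quad (x.1 + 1) * betaPoly (x.2 + 1)) := by
  rw [Finset.Nat.sum_antidiagonal_eq_sum_range_succ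
    (fun p r => (-1 : ℝ) ^ p * (LSer quad (p + 1) * betaPoly (r + 1)))]
  simp only [Finset.Nat.sum_antidiagonal_eq_sum_range_succ_mk, betaPoly_eq, Finset.mul_sum]
  rw [← Finset.sum_neg_distrib]
  simp only [← Finset.sum_neg_distrib]
  rw [Finset.sum_comm' (t' := Finset.range (2 * l - 1).succ)
    (s' := fun p => Finset.range ((2 * l - 1 - p + 1 + 1) / 2))]
  · refine Finset.sum_congr rfl fun p hp => Finset.sum_congr rfl fun k hk => ?_
    rw [Finset.mem_range] at hp hk
    rw [beta_eq (Nat.le_add_left 1 _), zeta_bar (Nat.le_add_left 1 _), LSer_quad,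
      show 2 * l - 1 - p + 1 - 2 * k = 2 * l - 1 - 2 * k - p + 1 by omega]
    rw [pow_add, pow_add]
    ring
  · intro k p
    simp only [Finset.mem_range]
    omega

theorem sum_antidiagonal_filter_le {M : Type*} [AddCommMonoid M] (F : ℕ × ℕ → M) (a b n : ℕ) :
    ∑ x ∈ (Finset.HasAntidiagonal.antidiagonal (n + a + b)).filter (fun x => a ≤ x.1 ∧ b ≤ x.2),
      F x = ∑ x ∈ Finset.HasAntidiagonal.antidiagonal n, F (x.1 + a, x.2 + b) := by
  refine Finset.sum_bij' (fun x _ => (x.1 - a, x.2 - b)) (fun x _ => (x.1 + a, x.2 + b))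
    ?_ ?_ ?_ ?_ ?_
  · rintro ⟨i, j⟩ h
    simp only [Finset.mem_filter, Finset.HasAntidiagonal.mem_antidiagonal] at h ⊢
    omega
  · rintro ⟨i, j⟩ h
    simp only [Finset.mem_filter, Finset.HasAntidiagonal.mem_antidiagonal] at h ⊢
    omega
  · rintro ⟨i, j⟩ h
    simp only [Finset.mem_filter, Finset.HasAntidiagonal.mem_antidiagonal] at h
    simp only [Nat.sub_add_cancel h.2.1, Nat.sub_add_cancel h.2.2]
  · rintro ⟨i, j⟩ h
    simp
  · rintro ⟨i, j⟩ h
    simp only [Finset.mem_filter, Finset.HasAntidiagonal.mem_antidiagonal] at h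
    simp only [Nat.sub_add_cancel h.2.1, Nat.sub_add_cancel h.2.2]

theorem summable_mul_hat {f g : ℕ → ℝ} (hg : ∃ B, ∀ n, 1 ≤ n → |g n| ≤ B) (hf : BddPartial f)
    {s : ℕ} (hs : 2 ≤ s) : Summable fun n : ℕ => g n / (n : ℝ) ^ s * hat f n := by
  obtain ⟨C, -, hC⟩ := hf.exists_bound_hat
  refine Summable.of_norm_bounded ((summable_div_pow hg hs).abs.mul_right C) fun n => ?_
  rw [norm_mul, Real.norm_eq_abs, Real.norm_eq_abs]
  exact mul_le_mul_of_nonneg_left (hC n) (abs_nonneg _)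

theorem quad_mul_chi (n : ℕ) : quad n * chi n = -2 * chi n := by
  rw [quad, alt, altEven, chi]
  split_ifs with h
  · simp
  · rw [(Nat.not_even_iff_odd.1 h).neg_one_pow]; ring

/-- The part of the moments with `LSer oddInd` is a product of Dirichlet series. Its partial
fraction expansion contains `hat₂ oddInd`, hence minus the `cosInt` series of `tsum_bco_div`, which
cancels. Since `quad` equals -2 on odd numbers, the leftover is the double sum in χ with factor 4.
-/
theorem S_args_eq {l : ℕ} (hl : 1 ≤ l) : S (args l) =
    -∑ x ∈ Finset.HasAntidiagonal.antidiagonal (2 * l - 1),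
        (-1 : ℝ) ^ x.1 * (LSer quad (x.1 + 1) * betaPoly (x.2 + 1)) +
      ∑' m : ℕ, oddInd m / (m : ℝ) ^ (2 * l + 1) * hat quad m +
      4 * ∑' n : ℕ, chi n / (n : ℝ) ^ (2 * l + 1) * hat chi n := by
  have hb : ∃ B, ∀ n, 1 ≤ n → |chi n| ≤ B := ⟨1, fun n _ => abs_chi_le n⟩
  have h1 : ∑ q ∈ Finset.Ico 1 (2 * l + 1),
      (Complex.I ^ q).re * powInt q * LSer quad (2 * l - q + 1) =
      ∑ x ∈ Finset.HasAntidiagonal.antidiagonal (2 * l - 1), (-1 : ℝ) ^ x.1 *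
        (LSer quad (x.1 + 1) * (LSer oddInd (x.2 + 2) - betaPoly (x.2 + 1))) := by
    rw [← Finset.Nat.sum_antidiagonal_swap]
    simp only [Prod.fst_swap, Prod.snd_swap]
    rw [Finset.Nat.sum_antidiagonal_eq_sum_range_succ (fun r p => (-1 : ℝ) ^ p *
      (LSer quad (p + 1) * (LSer oddInd (r + 2) - betaPoly (r + 1)))),
      Finset.sum_Ico_eq_sum_range]
    refine Finset.sum_congr (by congr 1; omega) fun r hr => ?_
    have hr' := Finset.mem_range.1 hr
    rw [← I_pow_re_mul_powInt (Nat.le_add_left 1 r), add_comm 1 r,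
      show 2 * l - (r + 1) = 2 * l - 1 - r by omega, I_pow_re, altEven]
    -- When r + 1 is even, 2l - 1 - r is even and the sign is +1; when r + 1 is odd both sides
    -- vanish, so the alternating sign may be inserted freely.
    split_ifs with h
    · have : Even (2 * l - 1 - r) := by
        rw [Nat.even_iff] at h ⊢; omega
      rw [this.neg_one_pow]
      ring
    · ring
  have h2 := sum_LSer_mul_LSer_of_bounded bddPartial_quad bounded_oddInd hl
  have h3 : ∑' n : ℕ, quad n / (n : ℝ) ^ (2 * l) * hat₂ oddInd n =
      ∑' n : ℕ, quad n / (n : ℝ) ^ (2 * l + 1) * cosInt n -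
        4 * ∑' n : ℕ, chi n / (n : ℝ) ^ (2 * l + 1) * hat chi n := by
    rw [← tsum_mul_left, ← (summable_quad_mul_cosInt hl).tsum_sub
      ((summable_mul_hat hb bddPartial_chi (by omega)).mul_left 4)]
    refine tsum_congr fun n => ?_
    rcases Nat.eq_zero_or_pos n with rfl | hn
    · simp [show l ≠ 0 by omega]
    · have hn' : (n : ℝ) ≠ 0 := by positivity
      have e1 := mul_hat₂_oddInd n
      have e2 := quad_mul_chi n
      rw [pow_succ]
      field_simp
      linear_combination quad n * e1 + 2 * hat chi n * e2
  rw [S, M, (tendsto_trunc_args hl).limUnder_eq, tsum_bco_div hl, h1]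
  simp only [mul_sub, Finset.sum_sub_distrib]
  rw [h2, h3]
  ring

theorem sum_beta_beta {l : ℕ} (hl : 1 ≤ l) :
    ∑ x ∈ Finset.HasAntidiagonal.antidiagonal (2 * l),
      2 * (-1 : ℝ) ^ x.1 * beta (x.2 + 1) * beta (x.1 + 1) =
      4 * ∑' n : ℕ, chi n / (n : ℝ) ^ (2 * l + 1) * hat chi n := by
  have h := sum_LSer_mul_LSer bddPartial_chi bddPartial_chi hl
  have e : ∑ x ∈ Finset.HasAntidiagonal.antidiagonal (2 * l),
      2 * (-1 : ℝ) ^ x.1 * beta (x.2 + 1) * beta (x.1 + 1) =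
      2 * ∑ x ∈ Finset.HasAntidiagonal.antidiagonal (2 * l),
        (-1 : ℝ) ^ x.1 * (LSer chi (x.1 + 1) * LSer chi (x.2 + 1)) := by
    rw [Finset.mul_sum]
    refine Finset.sum_congr rfl fun x _ => ?_
    rw [beta_eq (Nat.le_add_left 1 _), beta_eq (Nat.le_add_left 1 _)]
    ring
  rw [e, h]
  ring

theorem sum_zeta_zeta_bar {l : ℕ} (hl : 1 ≤ l) :
    ∑ x ∈ (Finset.HasAntidiagonal.antidiagonal (2 * l + 2)).filter (fun x => 1 ≤ x.1 ∧ 1 ≤ x.2),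
      (-1 : ℝ) ^ x.1 * zeta [bar x.1] * zeta [bar x.2] =
      -2 * ∑' n : ℕ, alt n / (n : ℝ) ^ (2 * l + 1) * hat alt n := by
  have h := sum_LSer_mul_LSer bddPartial_alt bddPartial_alt hl
  rw [sum_antidiagonal_filter_le _ 1 1 (2 * l)]
  have e : ∑ x ∈ Finset.HasAntidiagonal.antidiagonal (2 * l),
      (-1 : ℝ) ^ (x.1 + 1) * zeta [bar (x.1 + 1)] * zeta [bar (x.2 + 1)] =
      -∑ x ∈ Finset.HasAntidiagonal.antidiagonal (2 * l),
        (-1 : ℝ) ^ x.1 * (LSer alt (x.1 + 1) * LSer alt (x.2 + 1)) := by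
    rw [← Finset.sum_neg_distrib]
    refine Finset.sum_congr rfl fun x _ => ?_
    rw [zeta_bar (Nat.le_add_left 1 _), zeta_bar (Nat.le_add_left 1 _)]
    ring
  rw [e, h]
  ring

/-- The second double sum from partial fractions involves `hat₂` of the constant 1, which at n is
(`harm n` + 1/n)/n. Its two parts are exactly the depth two and depth one zeta values added on the
left. -/
theorem sum_zeta_bar_rzeta {l : ℕ} (hl : 1 ≤ l) :
    ∑ x ∈ (Finset.HasAntidiagonal.antidiagonal (2 * l + 2)).filter (fun x => 1 ≤ x.1 ∧ 2 ≤ x.2),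
      2 * (-1 : ℝ) ^ (x.1 + 1) * zeta [bar x.1] * rzeta x.2 +
      2 * zeta [bar (2 * l + 2)] + 2 * zeta [bar (2 * l + 1), pl 1] =
      2 * ∑' m : ℕ, 1 / (m : ℝ) ^ (2 * l + 1) * hat alt m := by
  have h := sum_LSer_mul_LSer_of_bounded bddPartial_alt bounded_one hl
  rw [show 2 * l + 2 = (2 * l - 1) + 1 + 2 by omega, sum_antidiagonal_filter_le _ 1 2 (2 * l - 1),
    show 2 * l - 1 + 1 + 2 = 2 * l + 2 by omega]
  have e : ∑ x ∈ Finset.HasAntidiagonal.antidiagonal (2 * l - 1),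
      2 * (-1 : ℝ) ^ (x.1 + 1 + 1) * zeta [bar (x.1 + 1)] * rzeta (x.2 + 2) =
      2 * ∑ x ∈ Finset.HasAntidiagonal.antidiagonal (2 * l - 1),
        (-1 : ℝ) ^ x.1 * (LSer alt (x.1 + 1) * LSer (fun _ => 1) (x.2 + 2)) := by
    rw [Finset.mul_sum]
    refine Finset.sum_congr rfl fun x _ => ?_
    rw [zeta_bar (Nat.le_add_left 1 _), rzeta_eq (Nat.le_add_left 2 _)]
    ring
  have h3 : ∑' n : ℕ, alt n / (n : ℝ) ^ (2 * l) * hat₂ (fun _ => 1) n =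
      LSer alt (2 * l + 2) + ∑' k : ℕ, alt k / (k : ℝ) ^ (2 * l + 1) * harm k := by
    rw [LSer_eq_tsum bddPartial_alt.exists_bound (Nat.le_add_left 2 _),
      ← (summable_div_pow bddPartial_alt.exists_bound (Nat.le_add_left 2 _)).tsum_add
        (summable_alt_mul_harm hl)]
    refine tsum_congr fun n => ?_
    rcases Nat.eq_zero_or_pos n with rfl | hn
    · simp [show l ≠ 0 by omega]
    · have hn' : (n : ℝ) ≠ 0 := by positivity
      have e1 := mul_hat₂_one n
      rw [harm, Finset.sum_Ico_succ_top hn, ← harm] at e1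
      rw [show hat₂ (fun _ => 1) n = (harm n + 1 / n) / n by rw [← e1]; field_simp]
      field_simp
      ring
  rw [e, h, h3, zeta_bar (by omega), zeta_bar_one hl]
  ring

/-- Expand `oddInd` only against `hat alt`; kept intact against `hat altEven`, it is the `t` value.
-/
theorem sum_oddInd_hat_quad {l : ℕ} (hl : 1 ≤ l) :
    ∑' m : ℕ, oddInd m / (m : ℝ) ^ (2 * l + 1) * hat quad m =
      2 * ∑' m : ℕ, 1 / (m : ℝ) ^ (2 * l + 1) * hat alt m -
        2 * ∑' n : ℕ, alt n / (n : ℝ) ^ (2 * l + 1) * hat alt n -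
        4 * t [bar 1, bar (2 * l + 1)] := by
  have hs : 2 ≤ 2 * l + 1 := by omega
  have s1 := summable_mul_hat bounded_one bddPartial_alt hs
  have s2 := summable_mul_hat bddPartial_alt.exists_bound bddPartial_alt hs
  have s3 : Summable fun b : ℕ => oddInd b / 2 / (b : ℝ) ^ (2 * l + 1) * hat altEven b :=
    ((summable_mul_hat bounded_oddInd bddPartial_altEven hs).div_const 2).congr fun b => by ring
  rw [t_bar_one_bar hs, ← tsum_mul_left, ← tsum_mul_left, ← tsum_mul_left,
    ← (s1.mul_left 2).tsum_sub (s2.mul_left 2),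
    ← ((s1.mul_left 2).sub (s2.mul_left 2)).tsum_sub (s3.mul_left 4)]
  refine tsum_congr fun n => ?_
  rw [hat_quad, oddInd, alt]
  ring

end AMMV

end

/-- The first five conjuncts say that the (in part only conditionally convergent) series in the
identity converge, so that the last one is an identity between honest values. -/
theorem mainTheorem8 (l : ℕ) (hl : 1 ≤ l) :
    AMMV.Converges (AMMV.parityS (AMMV.args l)) ∧
    (∀ p : ℕ, 1 ≤ p → AMMV.Converges (AMMV.parityConst 1 [AMMV.bar p])) ∧
    (∀ r : ℕ, 1 ≤ r → ∃ x : ℝ, Tendsto (AMMV.betaTrunc r) atTop (𝓝 x)) ∧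
    AMMV.Converges (AMMV.parityConst 1 [AMMV.bar (2 * l + 1), AMMV.pl 1]) ∧
    AMMV.Converges (AMMV.parityConst (-1) [AMMV.bar 1, AMMV.bar (2 * l + 1)]) ∧
    AMMV.S (AMMV.args l) =
      (∑ k ∈ Finset.range l, ∑ x ∈ Finset.HasAntidiagonal.antidiagonal (2 * l - 1 - 2 * k),
        2 * (-1 : ℝ) ^ (1 + k + x.1) * AMMV.beta (x.2 + 1) * (2 - 1 / 2 ^ x.1) *
          AMMV.zeta [AMMV.bar (x.1 + 1)] *
          (1 / ((2 * k + 1).factorial : ℝ) * (Real.pi / 2) ^ (2 * k + 1)))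
      + (∑ x ∈ Finset.HasAntidiagonal.antidiagonal (2 * l),
          2 * (-1 : ℝ) ^ x.1 * AMMV.beta (x.2 + 1) * AMMV.beta (x.1 + 1))
      + (∑ x ∈ (Finset.HasAntidiagonal.antidiagonal (2 * l + 2)).filter (fun x => 1 ≤ x.1 ∧ 1 ≤ x.2),
          (-1 : ℝ) ^ x.1 * AMMV.zeta [AMMV.bar x.1] * AMMV.zeta [AMMV.bar x.2])
      + (∑ x ∈ (Finset.HasAntidiagonal.antidiagonal (2 * l + 2)).filter (fun x => 1 ≤ x.1 ∧ 2 ≤ x.2),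
          2 * (-1 : ℝ) ^ (x.1 + 1) * AMMV.zeta [AMMV.bar x.1] * AMMV.rzeta x.2)
      + 2 * AMMV.zeta [AMMV.bar (2 * l + 2)]
      + 2 * AMMV.zeta [AMMV.bar (2 * l + 1), AMMV.pl 1]
      - 4 * AMMV.t [AMMV.bar 1, AMMV.bar (2 * l + 1)] := by
  refine ⟨⟨_, AMMV.tendsto_trunc_args hl⟩, fun p hp => ⟨_, AMMV.tendsto_trunc_bar hp⟩,
    fun r hr => ⟨_, AMMV.tendsto_betaTrunc hr⟩, ⟨_, AMMV.tendsto_trunc_bar_one hl⟩,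
    ⟨_, AMMV.tendsto_trunc_bar_one_bar (by omega)⟩, ?_⟩
  rw [AMMV.S_args_eq hl, AMMV.sum_beta_zeta_pi hl, AMMV.sum_beta_beta hl,
    AMMV.sum_zeta_zeta_bar hl, AMMV.sum_oddInd_hat_quad hl, ← AMMV.sum_zeta_bar_rzeta hl]
  ring
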